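/- **Setting.** An OLSC instance consists of $n$ targets $T_1,\dots,T_n$ in the plane, finitely many obstacles, an angle of view $0<\theta<\pi$, and ranges $0\le R_{\min}\le R_{\max}<\infty$. A target $T_i$ is a nondegenerate segment $\overline{P_i^sP_i^e}$ with midpoint $M_i$ and a nonzero orientation vector $D_i$ perpendicular to it; two different targets may meet only in points that are end points of both. An obstacle is a finite chain of segments. A camera is a pair $(x,\alpha)$ of a location $x\in\mathbb R^2$ and a viewing direction $\alpha$. Its frustum is the set of points $p$ with $R_{\min}\le |p-x|\le R_{\max}$ in the closed wedge with apex $x$, axis at angle $\alpha$ and opening angle $\theta$. A location $x$ has a strict frontal view of $T_i$ if the angle between $D_i$ and $x-M_i$ is $<\pi/2$ and no other target and no obstacle meets the interior of the triangle $xP_i^sP_i^e$. The camera $(x,\alpha)$ *covers* $T_i$ if $T_i$ lies in its frustum and $x$ lies in the closure of the set of locations with a strict frontal view of $T_i$ (so the boundary of the coverage constraints is admitted). For a set $S$ of targets let $A_S$ be the set of locations $x$ such that for some $\alpha$ the camera $(x,\alpha)$ covers all targets of $S$. The Camera Placement Field of $T_i$ is $\mathrm{CPF}_i=A_{\{T_i\}}$.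 Its critical points are its boundary vertices: the points of $\partial\,\mathrm{CPF}_i$ near which $\partial\,\mathrm{CPF}_i$ does not coincide with a single line or circle. The AOV circles are the circles through $p$ and $q$ of radius $|pq|/(2\sin\theta)$ (the chord $pq$ has inscribed angle $\theta$), where $p\ne q$ are end points of two different targets. Intersection points of two curves are the isolated points of their intersection. Let $\mathcal P$ be the set of all critical points of all CPFs, all intersection points of $\partial\,\mathrm{CPF}_i$ and $\partial\,\mathrm{CPF}_j$ $(i\ne j)$, and all intersection points of a $\partial\,\mathrm{CPF}_i$ with an AOV circle. Let $\mathcal R$ be the family of all sets of targets that are, for some $x\in\mathcal P$, maximal among the sets of all targets covered by a camera $(x,\alpha)$, $\alpha\in\mathbb R$. **Theorem.** For every OLSC instance: 1. $\mathcal P$ is finite. 2. For every nonempty set $S$ of targets and every $x\in A_S$ there is a $p\in\mathcal P\cap A_S$ that can be joined to $x$ by a path inside $A_S$. In particular, every nonempty set of targets that a single camera can cover simultaneously is covered by a single camera located at a point of $\mathcal P$. 3. Suppose that some $k$ cameras together cover all targets. Then the greedy set cover algorithm over $\mathcal R$ (repeatedly pick a member of $\mathcal R$ containing the largest number of still uncovered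 targets, ties broken arbitrarily) always reaches a cover of all targets, and every cover it produces has at most $(1+\ln n)\,k$ members; thus it is an $O(\log n)$-approximation of the minimum number of cameras. -/

import Mathlib

open Topology

/-- The Euclidean plane. -/
abbrev Plane : Type := EuclideanSpace ℝ (Fin 2)

/-- The unit vector at angle `α`, measured counter-clockwise from the positive x-axis. -/
noncomputable def viewDir (α : ℝ) : Plane := !₂[Real.cos α, Real.sin α]

/-- An oriented line segment target: a nondegenerate segment with an orientation vector
perpendicular to it. -/
structure OLSTarget where
  start : Plane
  finish : Plane
  orient : Plane
  start_ne_finish : start ≠ finish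
  orient_ne_zero : orient ≠ 0
  orient_perp : inner ℝ orient (finish - start) = 0

namespace OLSTarget

/-- The (closed) line segment of a target. -/
def seg (T : OLSTarget) : Set Plane := segment ℝ T.start T.finish

/-- The two end points of a target. -/
def ends (T : OLSTarget) : Set Plane := {T.start, T.finish}

end OLSTarget

/-- An instance of the oriented line segment coverage problem with `n` targets and `u` obstacles.
An obstacle is a finite chain of segments, each given by its two end points. -/
structure OLSC (n u : ℕ) where
  target : Fin n → OLSTarget
  obstacle : Fin u → List (Plane × Plane)
  /-- angle of view -/
  θ : ℝ
  Rmin : ℝ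
  Rmax : ℝ
  θ_pos : 0 < θ
  θ_lt_pi : θ < Real.pi
  Rmin_nonneg : 0 ≤ Rmin
  Rmin_le_Rmax : Rmin ≤ Rmax
  /-- targets may only intersect at their end points -/
  inter_subset_ends : ∀ i j, i ≠ j →
    (target i).seg ∩ (target j).seg ⊆ (target i).ends ∩ (target j).ends

namespace OLSC

variable {n u : ℕ}

/-- The frustum of a camera at `x` with viewing direction `α`: the points at distance between
`Rmin` and `Rmax` from `x` in the closed wedge with apex `x`, axis at angle `α` and opening
angle `θ`. -/
def frustum (I : OLSC n u) (x : Plane) (α : ℝ) : Set Plane :=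
  {p | I.Rmin ≤ dist x p ∧ dist x p ≤ I.Rmax ∧
    ‖p - x‖ * Real.cos (I.θ / 2) ≤ inner ℝ (viewDir α) (p - x)}

/-- Everything that can occlude target `i`: the other targets and the obstacles. -/
def occluders (I : OLSC n u) (i : Fin n) : Set Plane :=
  {y | (∃ j, j ≠ i ∧ y ∈ (I.target j).seg) ∨
    ∃ k, ∃ σ ∈ I.obstacle k, y ∈ segment ℝ σ.1 σ.2}

/-- From `x` the target `i` is seen from its front, and no sight line from `x` to an inner point
of the target meets an occluder on the way (equivalently, no occluder enters the interior of the
triangle spanned by `x` and the target; merely touching that triangle is not an occlusion). -/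
def StrictFrontalView (I : OLSC n u) (i : Fin n) (x : Plane) : Prop :=
  InnerProductGeometry.angle (I.target i).orient
      (x - midpoint ℝ (I.target i).start (I.target i).finish) < Real.pi / 2 ∧
    ∀ p ∈ openSegment ℝ (I.target i).start (I.target i).finish,
      Disjoint (openSegment ℝ x p) (I.occluders i)

/-- The locations with an unoccluded frontal view of target `i`, boundary included: a rotation of
exactly `π / 2` is admitted where it is a limit of unoccluded frontal views. -/
def frontalView (I : OLSC n u) (i : Fin n) : Set Plane :=
  closure {x | I.StrictFrontalView i x}

/-- A camera at `x` with viewing direction `α` fully covers target `i`. -/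
def Covers (I : OLSC n u) (x : Plane) (α : ℝ) (i : Fin n) : Prop :=
  (I.target i).seg ⊆ I.frustum x α ∧ x ∈ I.frontalView i

/-- The locations from which a single camera, suitably rotated, covers all targets of `S`
simultaneously. -/
def region (I : OLSC n u) (S : Finset (Fin n)) : Set Plane :=
  {x | ∃ α : ℝ, ∀ i ∈ S, I.Covers x α i}

/-- The Camera Placement Field of target `i`. -/
def cpf (I : OLSC n u) (i : Fin n) : Set Plane :=
  {x | ∃ α : ℝ, I.Covers x α i}

/-- The AOV circles of a chord `pq`: the circles through `p` and `q` in which the chord has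
inscribed angle `θ`, that is, those of radius `|pq| / (2 sin θ)`. -/
def aovCirclesOfChord (I : OLSC n u) (p q : Plane) : Set (Set Plane) :=
  {C | ∃ c : Plane, ∃ r : ℝ, r = dist p q / (2 * Real.sin I.θ) ∧
    C = Metric.sphere c r ∧ p ∈ C ∧ q ∈ C}

/-- The AOV circles of all pairs of targets: the chords connect an end point of one target with an
end point of another target. -/
def aovCircles (I : OLSC n u) : Set (Set Plane) :=
  {C | ∃ j k, j ≠ k ∧ ∃ p ∈ (I.target j).ends, ∃ q ∈ (I.target k).ends,
    p ≠ q ∧ C ∈ I.aovCirclesOfChord p q}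

end OLSC

/-- `Γ` is a straight line or a circle in the plane. -/
def IsLineOrCircle (Γ : Set Plane) : Prop :=
  (∃ v : Plane, ∃ b : ℝ, v ≠ 0 ∧ Γ = {x | inner ℝ v x = b}) ∨
    ∃ c : Plane, ∃ r : ℝ, 0 < r ∧ Γ = Metric.sphere c r

/-- The vertices along the boundary of a planar region `A`: the boundary points near which the
boundary is not just one straight or one circular arc passing through the point. -/
def vertices (A : Set Plane) : Set Plane :=
  {z | z ∈ frontier A ∧
    ¬ ∃ Γ, IsLineOrCircle Γ ∧ ∃ V ∈ 𝓝 z, frontier A ∩ V = Γ ∩ V}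

/-- The intersection points of two curves: the isolated points of their intersection. (Where two
curves overlap along an arc, the inner points of that arc are not intersection points.) -/
def crossings (A B : Set Plane) : Set Plane :=
  {z | ∃ V ∈ 𝓝 z, (A ∩ B) ∩ V = {z}}

namespace OLSC

variable {n u : ℕ}

/-- The candidate locations: the critical points of all CPFs, the pairwise intersection points of
CPF boundaries, and the intersection points of CPF boundaries with AOV circles. -/
def candidates (I : OLSC n u) : Set Plane :=
  (⋃ i, vertices (I.cpf i)) ∪
  {z | ∃ i j, i ≠ j ∧ z ∈ crossings (frontier (I.cpf i)) (frontier (I.cpf j))} ∪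
  {z | ∃ i, ∃ C ∈ I.aovCircles, z ∈ crossings (frontier (I.cpf i)) C}

open Classical in
/-- The set of targets covered by a camera at `x` with viewing direction `α`. -/
noncomputable def cov (I : OLSC n u) (x : Plane) (α : ℝ) : Finset (Fin n) :=
  Finset.univ.filter fun i => I.Covers x α i

/-- The configurations offered to set cover: for each candidate location, the maximal sets of
targets that a camera placed there can cover simultaneously. -/
def configurations (I : OLSC n u) : Set (Finset (Fin n)) :=
  {C | ∃ x ∈ I.candidates, Maximal (fun D => ∃ α : ℝ, D = I.cov x α) C}

end OLSC

/-- `GreedyRun R U l`: starting with the set `U` of uncovered elements, the greedy set cover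
algorithm over the family `R`, with some way of breaking ties, picks the sets in the list `l`, in
this order, and stops with everything covered. -/
inductive GreedyRun {ι : Type} [DecidableEq ι] (R : Set (Finset ι)) :
    Finset ι → List (Finset ι) → Prop
  | done : GreedyRun R ∅ []
  | pick (U C : Finset ι) (l : List (Finset ι)) (hU : U.Nonempty) (hC : C ∈ R)
      (hmax : ∀ D ∈ R, (D ∩ U).card ≤ (C ∩ U).card) (hl : GreedyRun R (U \ C) l) :
      GreedyRun R U (C :: l)

/-! ### Coordinates in the plane -/

/-! Finiteness. The strict frontal view, the range and the angle condition of a target depend only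
on the signs of finitely many functions `a |x|² + ⟨v, x⟩ + d`, collected in `targetFuns`. Two lines
or circles coincide or meet in finitely many points, so outside a finite set all functions of the
family vanishing at a point are multiples of a single `g` (`exists_finite_isRegularAt`). There a
sign-determined set is locally decided by the sign of `g`. This survives closure
(`LocSign.closure`), since every zero of a line or circle equation is a sign change, and so it holds
for the CPFs. A frontier point is then neither a vertex nor a crossing: the frontier is locally the
whole zero set of `g`, which has no isolated points.

Reaching a candidate. Backing a camera away along its viewing axis keeps all targets in the wedge,
and the CPFs are bounded, so the camera arrives at the frontier of some CPF
(`exists_joinedIn_frontier`). From there it follows the line or circle that forms this frontier. At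
a non-candidate, every other CPF frontier or AOV circle that imposes a tight constraint must
coincide locally with that curve, as otherwise the point would be a crossing; hence all constraints
persist along the curve (`eventually_mem_region`). The one place where directions to end points are
discontinuous, an end point itself, is a vertex (`mem_vertices_of_mem_ends`). If no candidate were
ever met, the frontier would contain an unbounded line, contradicting the maximal range, or a full
circle, contradicting that each such circle has a point behind the target
(`exists_candidate_of_mem_frontier`).

Greedy bound. Hence what any camera covers is contained in a configuration, so `k` cameras yield `k`
configurations covering everything. Each greedy pick then covers at least a fraction `1 / k` of what
is left (`GreedyRun.length_le`). -/

theorem Plane.inner_eq (u v : Plane) : inner ℝ u v = u 0 * v 0 + u 1 * v 1 := by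
  simp [PiLp.inner_apply, Fin.sum_univ_two]
  ring

theorem Plane.norm_sq_eq (u : Plane) : ‖u‖ ^ 2 = u 0 ^ 2 + u 1 ^ 2 := by
  simp [EuclideanSpace.norm_sq_eq, Fin.sum_univ_two]

theorem Plane.ext {u v : Plane} (h0 : u 0 = v 0) (h1 : u 1 = v 1) : u = v := by
  ext i
  fin_cases i
  · exact h0
  · exact h1

theorem Plane.mem_sphere_iff (c x : Plane) {r : ℝ} (hr : 0 ≤ r) :
    x ∈ Metric.sphere c r ↔ (x 0 - c 0) ^ 2 + (x 1 - c 1) ^ 2 - r ^ 2 = 0 := by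
  have := Plane.norm_sq_eq (x - c)
  simp only [PiLp.sub_apply] at this
  rw [mem_sphere_iff_norm, ← this, sub_eq_zero, sq_eq_sq₀ (norm_nonneg _) hr]

theorem Plane.continuous_mk {X : Type*} [TopologicalSpace X] {f g : X → ℝ}
    (hf : Continuous f) (hg : Continuous g) : Continuous fun t => (!₂[f t, g t] : Plane) := by
  refine (PiLp.continuous_toLp 2 _).comp ?_
  refine continuous_pi fun i => ?_
  fin_cases i
  · simpa using hf
  · simpa using hg

/-! ### Quadratic functions whose zero sets are lines or circles -/

/-- Functions of the form `a |x|² + ⟨v, x⟩ + d`. -/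
def IsQuad (f : Plane → ℝ) : Prop :=
  ∃ a b c d : ℝ, ∀ x, f x = a * (x 0 ^ 2 + x 1 ^ 2) + b * x 0 + c * x 1 + d

/-- Normalized equations of nondegenerate lines and circles. -/
def IsCurveFun (g : Plane → ℝ) : Prop :=
  (∃ b c d : ℝ, (b ≠ 0 ∨ c ≠ 0) ∧ ∀ x, g x = b * x 0 + c * x 1 + d) ∨
    ∃ p q r : ℝ, 0 < r ∧ ∀ x, g x = (x 0 - p) ^ 2 + (x 1 - q) ^ 2 - r ^ 2

theorem IsQuad.continuous {f : Plane → ℝ} (hf : IsQuad f) : Continuous f := by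
  obtain ⟨a, b, c, d, h⟩ := hf
  rw [funext h]
  fun_prop

theorem IsCurveFun.isQuad {g : Plane → ℝ} (hg : IsCurveFun g) : IsQuad g := by
  rcases hg with ⟨b, c, d, -, h⟩ | ⟨p, q, r, -, h⟩
  · exact ⟨0, b, c, d, fun x => by rw [h]; ring⟩
  · exact ⟨1, -2 * p, -2 * q, p ^ 2 + q ^ 2 - r ^ 2, fun x => by rw [h]; ring⟩

theorem isLineOrCircle_iff (Γ : Set Plane) :
    IsLineOrCircle Γ ↔ ∃ g, IsCurveFun g ∧ Γ = {x | g x = 0} := by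
  constructor
  · rintro (⟨v, b, hv, rfl⟩ | ⟨c, r, hr, rfl⟩)
    · refine ⟨fun x => v 0 * x 0 + v 1 * x 1 + -b, Or.inl ⟨_, _, _, ?_, fun x => rfl⟩, ?_⟩
      · by_contra! h
        exact hv (Plane.ext h.1 h.2)
      · ext x
        simp only [Set.mem_ofPred_eq, Plane.inner_eq]
        constructor <;> intro h <;> linarith
    · refine ⟨fun x => (x 0 - c 0) ^ 2 + (x 1 - c 1) ^ 2 - r ^ 2,
        Or.inr ⟨_, _, _, hr, fun x => rfl⟩, ?_⟩
      ext x
      exact Plane.mem_sphere_iff c x hr.le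
  · rintro ⟨g, ⟨b, c, d, hbc, h⟩ | ⟨p, q, r, hr, h⟩, rfl⟩
    · refine Or.inl ⟨!₂[b, c], -d, ?_, ?_⟩
      · intro h0
        have h1 := congrArg (fun v : Plane => v 0) h0
        have h2 := congrArg (fun v : Plane => v 1) h0
        simp at h1 h2
        tauto
      · ext x
        simp only [Set.mem_ofPred_eq, Plane.inner_eq, h]
        simp
        constructor <;> intro h <;> linarith
    · refine Or.inr ⟨!₂[p, q], r, hr, ?_⟩
      ext x
      rw [Plane.mem_sphere_iff _ _ hr.le]
      simp [h]

/-- A quadratic function vanishes identically, or has at most one zero, or is a multiple of the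
normalized equation of a line or circle. -/
theorem IsQuad.classify {f : Plane → ℝ} (hf : IsQuad f) :
    f = 0 ∨ {x | f x = 0}.Subsingleton ∨ ∃ g, ∃ l : ℝ, IsCurveFun g ∧ l ≠ 0 ∧ f = l • g := by
  obtain ⟨a, b, c, d, h⟩ := hf
  by_cases ha : a = 0
  · by_cases hbc : b ≠ 0 ∨ c ≠ 0
    · exact Or.inr (Or.inr ⟨f, 1, Or.inl ⟨b, c, d, hbc, fun x => by rw [h, ha]; ring⟩,
        one_ne_zero, by simp⟩)
    · push Not at hbc
      by_cases hd : d = 0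
      · left
        funext x
        simp [h, ha, hbc, hd]
      · right; left
        intro x hx
        simp [h, ha, hbc, hd] at hx
  · right
    -- Completing the square: `R` below is the squared radius, and for `R ≤ 0` at most the centre
    -- remains as a zero.
    have key : ∀ x, f x = a * ((x 0 - -b / (2 * a)) ^ 2 + (x 1 - -c / (2 * a)) ^ 2
        - (b ^ 2 / (4 * a ^ 2) + c ^ 2 / (4 * a ^ 2) - d / a)) := by
      intro x
      rw [h]
      field_simp
      ring
    set R := b ^ 2 / (4 * a ^ 2) + c ^ 2 / (4 * a ^ 2) - d / a
    by_cases hR : 0 < R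
    · right
      refine ⟨fun x => (x 0 - -b / (2 * a)) ^ 2 + (x 1 - -c / (2 * a)) ^ 2 - (√R) ^ 2, a,
        Or.inr ⟨_, _, √R, Real.sqrt_pos.2 hR, fun x => rfl⟩, ha, ?_⟩
      funext x
      rw [key, Real.sq_sqrt hR.le]
      rfl
    · left
      have aux : ∀ x : Plane, f x = 0 → x 0 = -b / (2 * a) ∧ x 1 = -c / (2 * a) := by
        intro x hx
        rw [key] at hx
        have h1 := (mul_eq_zero.1 hx).resolve_left ha
        have h2 : (x 0 - -b / (2 * a)) ^ 2 = 0 := by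
          nlinarith [sq_nonneg (x 0 - -b / (2 * a)), sq_nonneg (x 1 - -c / (2 * a))]
        have h3 : (x 1 - -c / (2 * a)) ^ 2 = 0 := by
          nlinarith [sq_nonneg (x 0 - -b / (2 * a)), sq_nonneg (x 1 - -c / (2 * a))]
        exact ⟨sub_eq_zero.1 (pow_eq_zero_iff two_ne_zero |>.1 h2),
          sub_eq_zero.1 (pow_eq_zero_iff two_ne_zero |>.1 h3)⟩
      intro x hx y hy
      exact Plane.ext ((aux x hx).1.trans (aux y hy).1.symm) ((aux x hx).2.trans (aux y hy).2.symm)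

theorem finite_quadratic_roots {A B C : ℝ} (hA : A ≠ 0) :
    {t : ℝ | A * t ^ 2 + B * t + C = 0}.Finite := by
  by_cases h : ∃ t₀, A * t₀ ^ 2 + B * t₀ + C = 0
  · obtain ⟨t₀, h₀⟩ := h
    -- By Vieta the other root is `-B / A - t₀`.
    refine (Set.toFinite {t₀, -B / A - t₀}).subset ?_
    intro t ht
    have h1 : (t - t₀) * (A * (t + t₀) + B) = 0 := by
      simp only [Set.mem_ofPred_eq] at ht
      linear_combination ht - h₀
    rcases mul_eq_zero.1 h1 with h2 | h2
    · left; linarith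
    · right
      simp only [Set.mem_singleton_iff]
      field_simp
      linarith
  · push Not at h
    convert Set.finite_empty
    ext t
    simp [h t]

/-- Write the points of the line as the foot of the perpendicular from the origin plus `t • (-c,
b)`. The circle equation becomes quadratic in `t` with leading coefficient `b² + c² ≠ 0`. -/
theorem finite_line_inter_circle {b c d p q r : ℝ} (hbc : b ≠ 0 ∨ c ≠ 0) :
    {x : Plane | b * x 0 + c * x 1 + d = 0 ∧
      (x 0 - p) ^ 2 + (x 1 - q) ^ 2 - r ^ 2 = 0}.Finite := by
  have hpos : b ^ 2 + c ^ 2 ≠ 0 := by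
    rcases hbc with h | h <;> positivity
  have hfin := finite_quadratic_roots (A := b ^ 2 + c ^ 2)
    (B := 2 * (c * (b * d / (b ^ 2 + c ^ 2) + p) - b * (c * d / (b ^ 2 + c ^ 2) + q)))
    (C := (b * d / (b ^ 2 + c ^ 2) + p) ^ 2 + (c * d / (b ^ 2 + c ^ 2) + q) ^ 2 - r ^ 2) hpos
  refine (hfin.image fun t => (!₂[-(b * d / (b ^ 2 + c ^ 2)) - c * t,
    -(c * d / (b ^ 2 + c ^ 2)) + b * t] : Plane)).subset ?_
  rintro x ⟨h1, h2⟩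
  have e0 : x 0 = -(b * d / (b ^ 2 + c ^ 2)) - c * ((b * x 1 - c * x 0) / (b ^ 2 + c ^ 2)) := by
    field_simp
    linear_combination b * h1
  have e1 : x 1 = -(c * d / (b ^ 2 + c ^ 2)) + b * ((b * x 1 - c * x 0) / (b ^ 2 + c ^ 2)) := by
    field_simp
    linear_combination c * h1
  refine ⟨(b * x 1 - c * x 0) / (b ^ 2 + c ^ 2), ?_, ?_⟩
  · generalize (b * x 1 - c * x 0) / (b ^ 2 + c ^ 2) = t at e0 e1
    simp only [Set.mem_ofPred_eq]
    rw [e0, e1] at h2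
    linear_combination h2
  · exact Plane.ext (by simpa using e0.symm) (by simpa using e1.symm)

/-- Two lines or circles coincide or meet in finitely many points. -/
theorem IsCurveFun.inter_finite {g g' : Plane → ℝ} (hg : IsCurveFun g) (hg' : IsCurveFun g') :
    {x | g x = 0 ∧ g' x = 0}.Finite ∨ ∃ l : ℝ, l ≠ 0 ∧ g' = l • g := by
  rcases hg with ⟨b, c, d, hbc, h⟩ | ⟨p, q, r, hr, h⟩
  · rcases hg' with ⟨b', c', d', hbc', h'⟩ | ⟨p', q', r', hr', h'⟩
    · by_cases hdet : b * c' - c * b' = 0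
      · obtain ⟨l, hl, hb, hc⟩ : ∃ l : ℝ, l ≠ 0 ∧ b' = l * b ∧ c' = l * c := by
          by_cases hb : b = 0
          · have hc : c ≠ 0 := by tauto
            have hb' : b' = 0 := by
              rw [hb] at hdet
              have : c * b' = 0 := by linarith
              exact (mul_eq_zero.1 this).resolve_left hc
            have hc' : c' ≠ 0 := by tauto
            exact ⟨c' / c, div_ne_zero hc' hc, by rw [hb, hb']; ring, by field_simp⟩
          · have hb' : b' ≠ 0 := by
              intro h0
              rw [h0] at hdet
              have : b * c' = 0 := by linarith
              have : c' = 0 := (mul_eq_zero.1 this).resolve_left hb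
              tauto
            refine ⟨b' / b, div_ne_zero hb' hb, by field_simp, ?_⟩
            field_simp
            linarith
        by_cases hd : d' = l * d
        · right
          refine ⟨l, hl, ?_⟩
          funext x
          simp only [Pi.smul_apply, smul_eq_mul, h, h', hb, hc, hd]
          ring
        · left
          convert Set.finite_empty
          ext x
          simp only [Set.mem_ofPred_eq, Set.mem_empty_iff_false, iff_false, h, h', hb, hc]
          rintro ⟨h1, h2⟩
          exact hd (by linear_combination h2 - l * h1)
      · left
        apply Set.Subsingleton.finite
        rintro x ⟨hx, hx'⟩ y ⟨hy, hy'⟩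
        rw [h] at hx hy
        rw [h'] at hx' hy'
        apply Plane.ext
        · apply mul_left_cancel₀ hdet
          linear_combination c' * (hx - hy) - c * (hx' - hy')
        · apply mul_left_cancel₀ hdet
          linear_combination b * (hx' - hy') - b' * (hx - hy)
    · left
      simp only [h, h']
      exact finite_line_inter_circle hbc
  · rcases hg' with ⟨b', c', d', hbc', h'⟩ | ⟨p', q', r', hr', h'⟩
    · left
      simp only [h, h', and_comm]
      exact finite_line_inter_circle hbc'
    · by_cases hpq : p = p' ∧ q = q'
      · obtain ⟨rfl, rfl⟩ := hpq
        by_cases hrr : r ^ 2 = r' ^ 2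
        · right
          refine ⟨1, one_ne_zero, ?_⟩
          funext x
          simp [h, h', hrr]
        · left
          convert Set.finite_empty
          ext x
          simp only [Set.mem_ofPred_eq, Set.mem_empty_iff_false, iff_false, h, h']
          rintro ⟨h1, h2⟩
          exact hrr (by linear_combination h2 - h1)
      · left
        -- The difference of the two circle equations is their radical axis, a genuine line because
        -- the centres differ.
        refine (finite_line_inter_circle (b := 2 * (p' - p)) (c := 2 * (q' - q))
          (d := p ^ 2 + q ^ 2 - r ^ 2 - p' ^ 2 - q' ^ 2 + r' ^ 2) (p := p) (q := q) (r := r)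
          ?_).subset ?_
        · by_contra! hh
          exact hpq ⟨by linarith [hh.1], by linarith [hh.2]⟩
        · rintro x ⟨h1, h2⟩
          rw [h] at h1
          rw [h'] at h2
          exact ⟨by linear_combination h1 - h2, h1⟩

theorem setOf_zero_eq_of_smul {g g' : Plane → ℝ} {l : ℝ} (hl : l ≠ 0) (h : g' = l • g) :
    {x | g' x = 0} = {x | g x = 0} := by
  ext x
  simp [h, hl]

/-- A line or circle can be traversed by a nowhere locally constant curve, which leaves every
bounded set or passes through every point. -/
theorem IsCurveFun.exists_param {g : Plane → ℝ} (hg : IsCurveFun g) {z : Plane} (hz : g z = 0) :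
    ∃ γ : ℝ → Plane, Continuous γ ∧ γ 0 = z ∧ (∀ t, g (γ t) = 0) ∧
      (∀ t, ∀ᶠ s in 𝓝[≠] t, γ s ≠ γ t) ∧
      ((∀ M : ℝ, ∃ t, 0 ≤ t ∧ M < ‖γ t‖) ∨
        ((∃ p q r : ℝ, 0 < r ∧ ∀ x, g x = (x 0 - p) ^ 2 + (x 1 - q) ^ 2 - r ^ 2) ∧
          ∀ x, g x = 0 → ∃ t, 0 ≤ t ∧ γ t = x)) := by
  rcases hg with ⟨b, c, d, hbc, h⟩ | ⟨p, q, r, hr, h⟩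
  · have hne : (!₂[c, -b] : Plane) ≠ 0 := by
      intro h0
      have h1 := congrArg (fun v : Plane => v 0) h0
      have h2 := congrArg (fun v : Plane => v 1) h0
      simp at h1 h2
      tauto
    refine ⟨fun t => z + t • !₂[c, -b], by fun_prop, by simp, fun t => ?_, fun t => ?_, Or.inl ?_⟩
    · rw [h] at hz ⊢
      simp
      linear_combination hz
    · filter_upwards [self_mem_nhdsWithin] with s hs heq
      have h3 := smul_left_injective ℝ hne (add_left_cancel heq)
      exact hs h3
    · intro M
      have hn : 0 < ‖(!₂[c, -b] : Plane)‖ := norm_pos_iff.2 hne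
      refine ⟨(|M| + 1 + ‖z‖) / ‖(!₂[c, -b] : Plane)‖, by positivity, ?_⟩
      have h1 := norm_sub_le (z + ((|M| + 1 + ‖z‖) / ‖(!₂[c, -b] : Plane)‖) • (!₂[c, -b] : Plane)) z
      rw [add_sub_cancel_left, norm_smul, Real.norm_of_nonneg (by positivity),
        div_mul_cancel₀ _ hn.ne'] at h1
      linarith [le_abs_self M]
  · have polar : ∀ x : Plane, g x = 0 → ∃ φ : ℝ, x 0 = p + r * Real.cos φ ∧
        x 1 = q + r * Real.sin φ := by
      intro x hx
      rw [h] at hx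
      let w : ℂ := ⟨x 0 - p, x 1 - q⟩
      have hw : ‖w‖ = r := by
        rw [← sq_eq_sq₀ (norm_nonneg _) hr.le, Complex.sq_norm, Complex.normSq_apply]
        change (x 0 - p) * (x 0 - p) + (x 1 - q) * (x 1 - q) = r ^ 2
        linear_combination hx
      refine ⟨Complex.arg w, ?_, ?_⟩
      · have := Complex.norm_mul_cos_arg w
        rw [hw] at this
        rw [this]
        change x 0 = p + (x 0 - p)
        ring
      · have := Complex.norm_mul_sin_arg w
        rw [hw] at this
        rw [this]
        change x 1 = q + (x 1 - q)
        ring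
    obtain ⟨φ, h0, h1⟩ := polar z hz
    refine ⟨fun t => !₂[p + r * Real.cos (φ + t), q + r * Real.sin (φ + t)],
      Plane.continuous_mk (by fun_prop) (by fun_prop), ?_, fun t => ?_, fun t => ?_,
      Or.inr ⟨⟨p, q, r, hr, h⟩, ?_⟩⟩
    · exact Plane.ext (by simp [h0]) (by simp [h1])
    · rw [h]
      simp
      linear_combination r ^ 2 * Real.sin_sq_add_cos_sq (φ + t)
    · have hnear : ∀ᶠ s in 𝓝[≠] t, |s - t| < 1 := by
        apply nhdsWithin_le_nhds
        have : Filter.Tendsto (fun s => |s - t|) (𝓝 t) (𝓝 |t - t|) :=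
          (Continuous.tendsto (by fun_prop) t)
        apply this.eventually_lt_const
        simp
      filter_upwards [self_mem_nhdsWithin, hnear] with s hs hst heq
      have e0 := congrArg (fun v : Plane => v 0) heq
      have e1 := congrArg (fun v : Plane => v 1) heq
      simp [hr.ne'] at e0 e1
      have hc : Real.cos (s - t) = 1 := by
        have : s - t = (φ + s) - (φ + t) := by ring
        rw [this, Real.cos_sub, e0, e1]
        nlinarith [Real.sin_sq_add_cos_sq (φ + t)]
      rw [abs_lt] at hst
      have := (Real.cos_eq_one_iff_of_lt_of_lt (by linarith [Real.pi_gt_three])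
        (by linarith [Real.pi_gt_three])).1 hc
      exact hs (by simpa [sub_eq_zero] using this)
    · intro x hx
      obtain ⟨ψ, k0, k1⟩ := polar x hx
      -- Adding `N` full turns makes the parameter nonnegative.
      obtain ⟨N, hN⟩ := exists_nat_gt ((φ - ψ) / (2 * Real.pi))
      have hN' : φ - ψ < N * (2 * Real.pi) := by
        rwa [div_lt_iff₀ (by positivity)] at hN
      refine ⟨ψ - φ + N * (2 * Real.pi), by linarith, ?_⟩
      have : φ + (ψ - φ + N * (2 * Real.pi)) = ψ + N * (2 * Real.pi) := by ring
      apply Plane.ext <;> simp [this, k0, k1]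

/-- Lines and circles have no isolated points. -/
theorem IsCurveFun.not_isolated {g : Plane → ℝ} (hg : IsCurveFun g) {z : Plane} (hz : g z = 0)
    {V : Set Plane} (hV : V ∈ 𝓝 z) : ∃ w ∈ V, g w = 0 ∧ w ≠ z := by
  obtain ⟨γ, hγ, h0, h1, h2, -⟩ := hg.exists_param hz
  have h3 : ∀ᶠ s in 𝓝[≠] (0 : ℝ), γ s ∈ V :=
    nhdsWithin_le_nhds (hγ.continuousAt.preimage_mem_nhds (by rwa [h0]))
  obtain ⟨s, hs, hs'⟩ := (h3.and (h2 0)).exists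
  exact ⟨γ s, hs, h1 s, by rwa [h0] at hs'⟩

theorem IsCurveFun.infinite_inter_nhds {g : Plane → ℝ} (hg : IsCurveFun g) {z : Plane}
    (hz : g z = 0) {V : Set Plane} (hV : V ∈ 𝓝 z) : ({x | g x = 0} ∩ V).Infinite := by
  intro hfin
  have h1 : (({x | g x = 0} ∩ V) \ {z})ᶜ ∈ 𝓝 z :=
    (hfin.subset Set.sdiff_subset).isClosed.isOpen_compl.mem_nhds (by simp)
  obtain ⟨w, hw, hgw, hne⟩ := hg.not_isolated hz (Filter.inter_mem hV h1)
  exact hw.2 ⟨⟨hgw, hw.1⟩, hne⟩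

/-- A displacement by `t` along the normal, respectively along the radius, gives `g` the value `t
(b² + c²)`, respectively `t (2 + t) r²`; both change sign at `t = 0`. -/
theorem IsCurveFun.mem_closure_pos {g : Plane → ℝ} (hg : IsCurveFun g) {z : Plane}
    (hz : g z = 0) : z ∈ closure {x | 0 < g x} ∧ z ∈ closure {x | g x < 0} := by
  rcases hg with ⟨b, c, d, hbc, h⟩ | ⟨p, q, r, hr, h⟩
  · have hpos : 0 < b ^ 2 + c ^ 2 := by rcases hbc with h | h <;> positivity
    have hval : ∀ t : ℝ, g (z + t • !₂[b, c]) = t * (b ^ 2 + c ^ 2) := by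
      intro t
      rw [h] at hz ⊢
      simp
      linear_combination hz
    have hcont : Filter.Tendsto (fun t : ℝ => z + t • (!₂[b, c] : Plane)) (𝓝 0) (𝓝 z) := by
      have : Continuous (fun t : ℝ => z + t • (!₂[b, c] : Plane)) := by fun_prop
      simpa using this.tendsto 0
    constructor
    · refine mem_closure_of_tendsto (hcont.mono_left (nhdsWithin_le_nhds (s := Set.Ioi 0))) ?_
      filter_upwards [self_mem_nhdsWithin] with t ht
      rw [hval]
      exact mul_pos ht hpos
    · refine mem_closure_of_tendsto (hcont.mono_left (nhdsWithin_le_nhds (s := Set.Iio 0))) ?_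
      filter_upwards [self_mem_nhdsWithin] with t ht
      rw [hval]
      exact mul_neg_of_neg_of_pos ht hpos
  · have hval : ∀ t : ℝ, g (z + t • (z - !₂[p, q])) = t * (2 + t) * r ^ 2 := by
      intro t
      rw [h] at hz ⊢
      simp
      linear_combination (1 + t) ^ 2 * hz
    have hcont : Filter.Tendsto (fun t : ℝ => z + t • (z - (!₂[p, q] : Plane))) (𝓝 0) (𝓝 z) := by
      have : Continuous (fun t : ℝ => z + t • (z - (!₂[p, q] : Plane))) := by fun_prop
      simpa using this.tendsto 0
    constructor
    · refine mem_closure_of_tendsto (hcont.mono_left (nhdsWithin_le_nhds (s := Set.Ioi 0))) ?_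
      filter_upwards [self_mem_nhdsWithin] with t (ht : 0 < t)
      rw [hval]
      positivity
    · refine mem_closure_of_tendsto (hcont.mono_left (nhdsWithin_le_nhds (s := Set.Iio 0))) ?_
      filter_upwards [self_mem_nhdsWithin, nhdsWithin_le_nhds (Ioi_mem_nhds (show (-2 : ℝ) < 0 by
        norm_num))] with t (ht : t < 0) (ht' : -2 < t)
      rw [hval]
      exact mul_neg_of_neg_of_pos (mul_neg_of_neg_of_pos ht (by linarith)) (by positivity)

/-! ### Sets that are locally cut out by the sign of one function -/

/-- Near `z`, membership in `A` depends only on the sign of `g`. -/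
def LocSign (g : Plane → ℝ) (A : Set Plane) (z : Plane) : Prop :=
  ∃ V ∈ 𝓝 z, ∀ x ∈ V, ∀ y ∈ V, SignType.sign (g x) = SignType.sign (g y) → x ∈ A → y ∈ A

/-- Membership in `A` depends only on the signs of the functions in `F`. -/
def Adapted (F : Set (Plane → ℝ)) (A : Set Plane) : Prop :=
  ∀ x y, (∀ f ∈ F, SignType.sign (f x) = SignType.sign (f y)) → x ∈ A → y ∈ A

/-- A continuous function all of whose zeros are sign changes. -/
def IsTame (g : Plane → ℝ) : Prop :=
  Continuous g ∧ ∀ w, g w = 0 → w ∈ closure {x | 0 < g x} ∧ w ∈ closure {x | g x < 0}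

theorem IsCurveFun.isTame {g : Plane → ℝ} (hg : IsCurveFun g) : IsTame g :=
  ⟨hg.isQuad.continuous, fun _ hw => hg.mem_closure_pos hw⟩

theorem isTame_one : IsTame fun _ => 1 :=
  ⟨continuous_const, fun _ h => absurd h one_ne_zero⟩

theorem Adapted.mono {F G : Set (Plane → ℝ)} {A : Set Plane} (h : Adapted F A) (hFG : F ⊆ G) :
    Adapted G A := fun x y hs => h x y fun f hf => hs f (hFG hf)

theorem LocSign.inter {g : Plane → ℝ} {A B : Set Plane} {z : Plane} (hA : LocSign g A z)
    (hB : LocSign g B z) : LocSign g (A ∩ B) z := by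
  obtain ⟨V, hV, h⟩ := hA
  obtain ⟨W, hW, h'⟩ := hB
  exact ⟨V ∩ W, Filter.inter_mem hV hW, fun x hx y hy hs hxAB =>
    ⟨h x hx.1 y hy.1 hs hxAB.1, h' x hx.2 y hy.2 hs hxAB.2⟩⟩

theorem LocSign.compl {g : Plane → ℝ} {A : Set Plane} {z : Plane} (hA : LocSign g A z) :
    LocSign g Aᶜ z := by
  obtain ⟨V, hV, h⟩ := hA
  exact ⟨V, hV, fun x hx y hy hs hxA hyA => hxA (h y hy x hx hs.symm hyA)⟩

theorem eventually_sign_eq {g : Plane → ℝ} (hg : Continuous g) {x : Plane} (hx : g x ≠ 0) :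
    ∀ᶠ y in 𝓝 x, SignType.sign (g y) = SignType.sign (g x) := by
  rcases lt_or_gt_of_ne hx with h | h
  · filter_upwards [hg.continuousAt.eventually_lt_const h] with y hy
    rw [sign_neg hy, sign_neg h]
  · filter_upwards [hg.continuousAt.eventually_const_lt h] with y hy
    rw [sign_pos hy, sign_pos h]

/-- Only zeros of `g` need an argument. If one zero is a limit of points of `A`, then some nearby
point of `A` has a certain sign. Unless it is a zero too, tameness supplies points of the same sign
arbitrarily close to any other nearby zero, and these also belong to `A`. -/
theorem LocSign.closure {g : Plane → ℝ} {A : Set Plane} {z : Plane} (hg : IsTame g)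
    (hA : LocSign g A z) : LocSign g (closure A) z := by
  obtain ⟨V, hV, h⟩ := hA
  obtain ⟨W, hWV, hWo, hzW⟩ := mem_nhds_iff.1 hV
  refine ⟨W, hWo.mem_nhds hzW, fun x hx y hy hs hxA => ?_⟩
  by_cases hgx : g x = 0
  · have hgy : g y = 0 := by rw [hgx, sign_zero] at hs; exact sign_eq_zero_iff.1 hs.symm
    obtain ⟨w, hwW, hwA⟩ := mem_closure_iff.1 hxA W hWo hx
    rcases lt_trichotomy (g w) 0 with hw | hw | hw
    · refine mem_closure_iff.2 fun O hO hyO => ?_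
      obtain ⟨v, hv, hv'⟩ := mem_closure_iff.1 (hg.2 y hgy).2 (O ∩ W) (hO.inter hWo) ⟨hyO, hy⟩
      refine ⟨v, hv.1, h w (hWV hwW) v (hWV hv.2) ?_ hwA⟩
      rw [sign_neg hw, sign_neg hv']
    · exact subset_closure (h w (hWV hwW) y (hWV hy) (by rw [hw, hgy]) hwA)
    · refine mem_closure_iff.2 fun O hO hyO => ?_
      obtain ⟨v, hv, hv'⟩ := mem_closure_iff.1 (hg.2 y hgy).1 (O ∩ W) (hO.inter hWo) ⟨hyO, hy⟩
      refine ⟨v, hv.1, h w (hWV hwW) v (hWV hv.2) ?_ hwA⟩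
      rw [sign_pos hw, sign_pos hv']
  · obtain ⟨U, hU, hUo, hxU⟩ := mem_nhds_iff.1 (eventually_sign_eq hg.1 hgx)
    obtain ⟨w, hw, hwA⟩ := mem_closure_iff.1 hxA (U ∩ W) (hUo.inter hWo) ⟨hxU, hx⟩
    exact subset_closure (h w (hWV hw.2) y (hWV hy) ((hU hw.1).trans hs) hwA)

/-- The frontier of a set that is locally cut out by the sign of `g` is locally the zero set
of `g`. -/
theorem LocSign.frontier_eq {g : Plane → ℝ} {A : Set Plane} {z : Plane} (hg : IsTame g)
    (hA : LocSign g A z) (hz : z ∈ frontier A) :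
    g z = 0 ∧ ∃ V ∈ 𝓝 z, frontier A ∩ V = {x | g x = 0} ∩ V := by
  have hF : LocSign g (frontier A) z := by
    rw [frontier_eq_closure_inter_closure]
    exact (hA.closure hg).inter (hA.compl.closure hg)
  obtain ⟨V, hV, h⟩ := hA
  obtain ⟨V', hV', h'⟩ := hF
  obtain ⟨W, hWV, hWo, hzW⟩ := mem_nhds_iff.1 (Filter.inter_mem hV hV')
  have hzero : ∀ x ∈ W, x ∈ frontier A → g x = 0 := by
    intro x hx hxF
    by_contra hgx
    obtain ⟨U, hU, hUo, hxU⟩ := mem_nhds_iff.1 (eventually_sign_eq hg.1 hgx)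
    rw [frontier_eq_closure_inter_closure] at hxF
    obtain ⟨w, hw, hwA⟩ := mem_closure_iff.1 hxF.1 (U ∩ W) (hUo.inter hWo) ⟨hxU, hx⟩
    obtain ⟨v, hv, hvA⟩ := mem_closure_iff.1 hxF.2 (U ∩ W) (hUo.inter hWo) ⟨hxU, hx⟩
    exact hvA (h w (hWV hw.2).1 v (hWV hv.2).1 ((hU hw.1).trans (hU hv.1).symm) hwA)
  have hgz := hzero z hzW hz
  refine ⟨hgz, W, hWo.mem_nhds hzW, ?_⟩
  ext x
  constructor
  · rintro ⟨hx, hxW⟩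
    exact ⟨hzero x hxW hx, hxW⟩
  · rintro ⟨hx : g x = 0, hxW⟩
    exact ⟨h' z (hWV hzW).2 x (hWV hxW).2 (by rw [hgz, hx]) hz, hxW⟩

/-! ### Regular points of a finite family of quadratic functions -/

/-- At `z`, all functions of `F` vanishing at `z` are multiples of `g`, which is either a constant
or the equation of a line or circle taken from `F`. -/
def IsRegularAt (F : Set (Plane → ℝ)) (z : Plane) (g : Plane → ℝ) : Prop :=
  (g = (fun _ => 1) ∨ IsCurveFun g ∧ ∃ f ∈ F, ∃ l : ℝ, l ≠ 0 ∧ f = l • g) ∧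
    ∀ f ∈ F, f z ≠ 0 ∨ ∃ l : ℝ, f = l • g

theorem IsRegularAt.isTame {F : Set (Plane → ℝ)} {z : Plane} {g : Plane → ℝ}
    (h : IsRegularAt F z g) : IsTame g := by
  rcases h.1 with rfl | ⟨h1, -⟩
  · exact isTame_one
  · exact h1.isTame

theorem IsRegularAt.isCurveFun {F : Set (Plane → ℝ)} {z : Plane} {g : Plane → ℝ}
    (h : IsRegularAt F z g) (hz : g z = 0) :
    IsCurveFun g ∧ ∃ f ∈ F, ∃ l : ℝ, l ≠ 0 ∧ f = l • g := by
  rcases h.1 with rfl | h1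
  · exact absurd hz one_ne_zero
  · exact h1

/-- The exceptional set collects the finite common zero sets of pairs from `F`; the pairs with `f =
f'` remove isolated zeros. At any other point, two members that vanish there without vanishing
identically share infinitely many zeros, so their lines or circles coincide. -/
theorem exists_finite_isRegularAt {F : Set (Plane → ℝ)} (hF : F.Finite)
    (hq : ∀ f ∈ F, IsQuad f) : ∃ Z : Set Plane, Z.Finite ∧ ∀ z ∉ Z, ∃ g, IsRegularAt F z g := by
  classical
  refine ⟨⋃ f ∈ F, ⋃ f' ∈ F, if {x | f x = 0 ∧ f' x = 0}.Finite then {x | f x = 0 ∧ f' x = 0}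
    else ∅, ?_, ?_⟩
  · refine hF.biUnion fun f _ => hF.biUnion fun f' _ => ?_
    split_ifs with h
    · exact h
    · exact Set.finite_empty
  · intro z hz
    have hinf : ∀ f ∈ F, ∀ f' ∈ F, f z = 0 → f' z = 0 → ¬ {x | f x = 0 ∧ f' x = 0}.Finite := by
      intro f hf f' hf' h h' hfin
      refine hz (Set.mem_biUnion hf (Set.mem_biUnion hf' ?_))
      rw [if_pos hfin]
      exact ⟨h, h'⟩
    by_cases hall : ∀ f ∈ F, f z ≠ 0 ∨ f = 0
    · exact ⟨fun _ => 1, Or.inl rfl, fun f hf => (hall f hf).imp_right fun h => ⟨0, by simp [h]⟩⟩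
    · push Not at hall
      obtain ⟨f, hf, hfz, hf0⟩ := hall
      rcases (hq f hf).classify with h | h | ⟨g, l, hg, hl, hfg⟩
      · exact absurd h hf0
      · exact absurd (h.finite.subset fun x hx => hx.1) (hinf f hf f hf hfz hfz)
      · refine ⟨g, Or.inr ⟨hg, f, hf, l, hl, hfg⟩, fun f' hf' => ?_⟩
        by_cases hf'z : f' z = 0
        · right
          rcases (hq f' hf').classify with h | h | ⟨g', l', hg', hl', hfg'⟩
          · exact ⟨0, by simp [h]⟩
          · exact absurd (h.finite.subset fun x hx => hx.2) (hinf f hf f' hf' hfz hf'z)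
          · rcases hg.inter_finite hg' with hfin | ⟨m, hm, hgg⟩
            · refine absurd (hfin.subset ?_) (hinf f hf f' hf' hfz hf'z)
              rintro x ⟨h1, h2⟩
              simp [hfg, hl] at h1
              simp [hfg', hl'] at h2
              exact ⟨h1, h2⟩
            · exact ⟨l' * m, by rw [hfg', hgg, smul_smul]⟩
        · exact Or.inl hf'z

/-- Functions nonzero at `z` keep their sign nearby, and the sign of a multiple of `g` is a function
of the sign of `g`. -/
theorem Adapted.locSign {F : Set (Plane → ℝ)} (hF : F.Finite) (hq : ∀ f ∈ F, IsQuad f)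
    {A : Set Plane} (hA : Adapted F A) {z : Plane} {g : Plane → ℝ} (hg : IsRegularAt F z g) :
    LocSign g A z := by
  refine ⟨{x | ∀ f ∈ F, f z ≠ 0 → SignType.sign (f x) = SignType.sign (f z)}, ?_, ?_⟩
  · refine (Filter.eventually_all_finite hF).2 fun f hf => ?_
    by_cases h : f z = 0
    · simp [h]
    · filter_upwards [eventually_sign_eq (hq f hf).continuous h] with x hx _ using hx
  · intro x hx y hy hs
    refine hA x y fun f hf => ?_
    rcases hg.2 f hf with h | ⟨l, hl⟩
    · rw [hx f hf h, hy f hf h]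
    · simp only [hl, Pi.smul_apply, smul_eq_mul, sign_mul, hs]

theorem IsRegularAt.notMem_vertices {F : Set (Plane → ℝ)} {z : Plane} {g : Plane → ℝ}
    (hg : IsRegularAt F z g) {A : Set Plane} (hA : LocSign g A z) : z ∉ vertices A := by
  rintro ⟨hz, hno⟩
  obtain ⟨hgz, V, hV, h⟩ := hA.frontier_eq hg.isTame hz
  exact hno ⟨_, (isLineOrCircle_iff _).2 ⟨g, (hg.isCurveFun hgz).1, rfl⟩, V, hV, h⟩

/-- Both frontiers agree near `z` with the zero set of the same `g`, in which `z` is not isolated.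
-/
theorem IsRegularAt.notMem_crossings {F : Set (Plane → ℝ)} {z : Plane} {g : Plane → ℝ}
    (hg : IsRegularAt F z g) {A B : Set Plane} (hA : LocSign g A z) (hB : LocSign g B z) :
    z ∉ crossings (frontier A) (frontier B) := by
  rintro ⟨V, hV, h⟩
  have hz : z ∈ frontier A ∩ frontier B ∩ V := by rw [h]; rfl
  obtain ⟨hgz, W, hW, h1⟩ := hA.frontier_eq hg.isTame hz.1.1
  obtain ⟨-, W', hW', h2⟩ := hB.frontier_eq hg.isTame hz.1.2
  obtain ⟨w, ⟨hwV, hwW, hwW'⟩, hgw, hne⟩ := (hg.isCurveFun hgz).1.not_isolated hgz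
    (Filter.inter_mem hV (Filter.inter_mem hW hW'))
  have e1 : w ∈ frontier A ∩ W := by rw [h1]; exact ⟨hgw, hwW⟩
  have e2 : w ∈ frontier B ∩ W' := by rw [h2]; exact ⟨hgw, hwW'⟩
  have : w ∈ frontier A ∩ frontier B ∩ V := ⟨⟨e1.1, e2.1⟩, hwV⟩
  rw [h] at this
  exact hne this

/-! ### Wedges -/

theorem inner_viewDir (a b : ℝ) : inner ℝ (viewDir a) (viewDir b) = Real.cos (a - b) := by
  simp [Plane.inner_eq, viewDir, Real.cos_sub]

theorem norm_viewDir (a : ℝ) : ‖viewDir a‖ = 1 := by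
  rw [← sq_eq_sq₀ (norm_nonneg _) zero_le_one, Plane.norm_sq_eq]
  simp [viewDir]

theorem exists_polar (α : ℝ) (v : Plane) :
    ∃ a, -Real.pi < a ∧ a ≤ Real.pi ∧ v = ‖v‖ • viewDir (α + a) := by
  let w : ℂ := ⟨v 0, v 1⟩
  have hw : ‖w‖ = ‖v‖ := by
    rw [← sq_eq_sq₀ (norm_nonneg _) (norm_nonneg _), Complex.sq_norm, Complex.normSq_apply,
      Plane.norm_sq_eq]
    change v 0 * v 0 + v 1 * v 1 = v 0 ^ 2 + v 1 ^ 2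
    ring
  obtain ⟨h1, h2⟩ := toIocMod_mem_Ioc Real.two_pi_pos (-Real.pi) (Complex.arg w - α)
  refine ⟨toIocMod Real.two_pi_pos (-Real.pi) (Complex.arg w - α), h1, by linarith, ?_⟩
  have h3 : α + toIocMod Real.two_pi_pos (-Real.pi) (Complex.arg w - α)
      = Complex.arg w - toIocDiv Real.two_pi_pos (-Real.pi) (Complex.arg w - α) *
        (2 * Real.pi) := by
    rw [toIocMod, zsmul_eq_mul]
    ring
  have hc := Complex.norm_mul_cos_arg w
  have hs := Complex.norm_mul_sin_arg w
  rw [hw] at hc hs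
  rw [h3]
  apply Plane.ext
  · simp only [viewDir, PiLp.smul_apply, smul_eq_mul, Matrix.cons_val_zero,
      Real.cos_sub_int_mul_two_pi]
    exact hc.symm
  · simp only [viewDir, PiLp.smul_apply, smul_eq_mul, Matrix.cons_val_one,
      Real.sin_sub_int_mul_two_pi]
    exact hs.symm

theorem abs_le_of_cos_le_cos {a t : ℝ} (ha : |a| ≤ Real.pi) (ht : 0 ≤ t)
    (h : Real.cos t ≤ Real.cos a) : |a| ≤ t := by
  by_contra! hlt
  rw [← Real.cos_abs a] at h
  exact absurd (Real.cos_lt_cos_of_nonneg_of_le_pi ht ha hlt) (not_lt.2 h)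

theorem cos_le_cos_of_abs_le_pi {a t : ℝ} (ht : t ≤ Real.pi) (h : |a| ≤ t) :
    Real.cos t ≤ Real.cos a := by
  rw [← Real.cos_abs a]
  exact Real.cos_le_cos_of_nonneg_of_le_pi (abs_nonneg a) ht h

/-- The vector `u` lies in the closed wedge with axis at angle `α` and opening angle `θ`. -/
def InWedge (θ α : ℝ) (u : Plane) : Prop :=
  ‖u‖ * Real.cos (θ / 2) ≤ inner ℝ (viewDir α) u

/-- The angle between `u` and `v` is at most `θ` (or one of the vectors vanishes). -/
def AngleLE (θ : ℝ) (u v : Plane) : Prop :=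
  Real.cos θ * (‖u‖ * ‖v‖) ≤ inner ℝ u v

theorem inWedge_polar {θ α a : ℝ} {u : Plane} (hu : u = ‖u‖ • viewDir (α + a)) (h0 : u ≠ 0)
    {β : ℝ} : InWedge θ (α + β) u ↔ Real.cos (θ / 2) ≤ Real.cos (β - a) := by
  have hpos : 0 < ‖u‖ := norm_pos_iff.2 h0
  have h1 : inner ℝ (viewDir (α + β)) u = ‖u‖ * Real.cos (β - a) := by
    conv_lhs => rw [hu]
    rw [real_inner_smul_right, inner_viewDir]
    congr 2
    ring
  rw [InWedge, h1, mul_le_mul_iff_right₀ hpos]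

theorem angleLE_polar {θ α a b : ℝ} {u v : Plane} (hu : u = ‖u‖ • viewDir (α + a))
    (hv : v = ‖v‖ • viewDir (α + b)) (hu0 : u ≠ 0) (hv0 : v ≠ 0) :
    AngleLE θ u v ↔ Real.cos θ ≤ Real.cos (a - b) := by
  have hpos : 0 < ‖u‖ * ‖v‖ := mul_pos (norm_pos_iff.2 hu0) (norm_pos_iff.2 hv0)
  have h1 : inner ℝ u v = Real.cos (a - b) * (‖u‖ * ‖v‖) := by
    conv_lhs => rw [hu, hv]
    rw [real_inner_smul_right, real_inner_smul_left, inner_viewDir]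
    have : α + a - (α + b) = a - b := by ring
    rw [this]
    ring
  rw [AngleLE, h1, mul_le_mul_iff_left₀ hpos]

theorem InWedge.zero {θ α : ℝ} : InWedge θ α 0 := by simp [InWedge]

theorem InWedge.angleLE {θ α : ℝ} (h0 : 0 < θ) (hpi : θ < Real.pi) {u v : Plane}
    (hu : InWedge θ α u) (hv : InWedge θ α v) : AngleLE θ u v := by
  by_cases hu0 : u = 0
  · simp [AngleLE, hu0]
  by_cases hv0 : v = 0
  · simp [AngleLE, hv0]
  obtain ⟨a, ha1, ha2, hap⟩ := exists_polar α u
  obtain ⟨b, hb1, hb2, hbp⟩ := exists_polar α v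
  have ha := (inWedge_polar (θ := θ) hap hu0 (β := 0)).1 (by rwa [add_zero])
  have hb := (inWedge_polar (θ := θ) hbp hv0 (β := 0)).1 (by rwa [add_zero])
  rw [zero_sub, Real.cos_neg] at ha hb
  have ha' := abs_le.1 (abs_le_of_cos_le_cos (abs_le.2 ⟨ha1.le, ha2⟩) (by linarith) ha)
  have hb' := abs_le.1 (abs_le_of_cos_le_cos (abs_le.2 ⟨hb1.le, hb2⟩) (by linarith) hb)
  rw [angleLE_polar hap hbp hu0 hv0]
  exact cos_le_cos_of_abs_le_pi hpi.le (abs_le.2 ⟨by linarith, by linarith⟩)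

theorem exists_inWedge_self {θ : ℝ} (v : Plane) : ∃ α, InWedge θ α v := by
  obtain ⟨a, -, -, hap⟩ := exists_polar 0 v
  refine ⟨0 + a, ?_⟩
  by_cases hv0 : v = 0
  · rw [hv0]; exact .zero
  · rw [inWedge_polar hap hv0, sub_self, Real.cos_zero]
    exact Real.cos_le_one _

theorem exists_inWedge_pair_iff {θ : ℝ} (h0 : 0 < θ) (hpi : θ < Real.pi) (u v : Plane) :
    (∃ α, InWedge θ α u ∧ InWedge θ α v) ↔ AngleLE θ u v := by
  refine ⟨fun ⟨α, hu, hv⟩ => hu.angleLE h0 hpi hv, fun h => ?_⟩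
  by_cases hu0 : u = 0
  · obtain ⟨α, hα⟩ := exists_inWedge_self (θ := θ) v
    exact ⟨α, hu0 ▸ .zero, hα⟩
  by_cases hv0 : v = 0
  · obtain ⟨α, hα⟩ := exists_inWedge_self (θ := θ) u
    exact ⟨α, hα, hv0 ▸ .zero⟩
  obtain ⟨a, -, -, hap⟩ := exists_polar 0 u
  obtain ⟨b, hb1, hb2, hbp⟩ := exists_polar a v
  rw [zero_add] at hap
  have hap' : u = ‖u‖ • viewDir (a + 0) := by rwa [add_zero]
  have hb := (angleLE_polar hap' hbp hu0 hv0).1 h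
  rw [zero_sub, Real.cos_neg] at hb
  have hb' := abs_le.1 (abs_le_of_cos_le_cos (abs_le.2 ⟨hb1.le, hb2⟩) h0.le hb)
  -- The axis is the bisector of the two directions.
  refine ⟨a + b / 2, ?_, ?_⟩
  · rw [inWedge_polar hap' hu0]
    exact cos_le_cos_of_abs_le_pi (by linarith) (abs_le.2 ⟨by linarith, by linarith⟩)
  · rw [inWedge_polar hbp hv0]
    exact cos_le_cos_of_abs_le_pi (by linarith) (abs_le.2 ⟨by linarith, by linarith⟩)

/-- If finitely many points lie in a wedge with apex `z`, then at locations near `z` they lie in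
a common wedge as soon as any two of them do. -/
theorem eventually_exists_inWedge {θ : ℝ} (h0 : 0 < θ) (hpi : θ < Real.pi) {E : Set Plane}
    (hE : E.Finite) {z : Plane} (hz : z ∉ E) {α : ℝ} (h : ∀ p ∈ E, InWedge θ α (p - z)) :
    ∀ᶠ w in 𝓝 z, (∀ p ∈ E, ∀ q ∈ E, AngleLE θ (p - w) (q - w)) →
      ∃ β, ∀ p ∈ E, InWedge θ β (p - w) := by
  -- Because `θ < π`, the points of `E` lie strictly in front of `z`, and of every nearby `w`. Their
  -- angles relative to `α` then lie in `(-π/2, π/2)`, so angle differences do not wrap around and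
  -- pairwise bounds control the total spread.
  have hnear : ∀ᶠ w in 𝓝 z, ∀ p ∈ E, 0 < inner ℝ (viewDir α) (p - w) := by
    refine (Filter.eventually_all_finite hE).2 fun p hp => ?_
    have hc : Continuous fun w : Plane => inner ℝ (viewDir α) (p - w) := by fun_prop
    refine hc.continuousAt.eventually_const_lt (lt_of_lt_of_le ?_ (h p hp))
    refine mul_pos (norm_pos_iff.2 (sub_ne_zero.2 fun e => hz (e ▸ hp))) ?_
    exact Real.cos_pos_of_mem_Ioo ⟨by linarith, by linarith⟩
  filter_upwards [hnear] with w hw hpair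
  rcases E.eq_empty_or_nonempty with rfl | hne
  · exact ⟨0, by simp⟩
  have hne0 : ∀ p ∈ E, p - w ≠ 0 := by
    intro p hp e
    have := hw p hp
    simp [e] at this
  choose a ha1 ha2 hap using fun p : Plane => exists_polar α (p - w)
  have hlt : ∀ p ∈ E, |a p| < Real.pi / 2 := by
    intro p hp
    by_contra! hle
    have h1 := hw p hp
    rw [hap p, real_inner_smul_right, inner_viewDir] at h1
    have h2 : Real.cos (α - (α + a p)) ≤ 0 := by
      have : α - (α + a p) = -a p := by ring
      rw [this, Real.cos_neg, ← Real.cos_abs]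
      exact Real.cos_nonpos_of_pi_div_two_le_of_le hle
        (by linarith [abs_le.2 ⟨(ha1 p).le, ha2 p⟩, Real.pi_pos])
    exact absurd (mul_nonpos_of_nonneg_of_nonpos (norm_nonneg (p - w)) h2) (not_le.2 h1)
  have hdiff : ∀ p ∈ E, ∀ q ∈ E, a p - a q ≤ θ := by
    intro p hp q hq
    have h1 := (angleLE_polar (hap p) (hap q) (hne0 p hp) (hne0 q hq)).1 (hpair p hp q hq)
    have h2 := abs_lt.1 (hlt p hp)
    have h3 := abs_lt.1 (hlt q hq)
    exact (abs_le.1 (abs_le_of_cos_le_cos (abs_le.2 ⟨by linarith, by linarith⟩) h0.le h1)).2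
  obtain ⟨P, hP, hPmax⟩ := Set.exists_max_image E a hE hne
  obtain ⟨Q, hQ, hQmin⟩ := Set.exists_min_image E a hE hne
  -- The axis bisects the two extreme directions.
  refine ⟨α + (a P + a Q) / 2, fun p hp => ?_⟩
  rw [inWedge_polar (hap p) (hne0 p hp)]
  have h1 := hPmax p hp
  have h2 := hQmin p hp
  have h3 := hdiff P hP Q hQ
  exact cos_le_cos_of_abs_le_pi (by linarith) (abs_le.2 ⟨by linarith, by linarith⟩)

/-- Moving the apex of a wedge backwards along its axis enlarges the wedge. -/
theorem InWedge.add_smul {θ α : ℝ} (h0 : 0 < θ) (hpi : θ < Real.pi) {u : Plane}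
    (hu : InWedge θ α u) {t : ℝ} (ht : 0 ≤ t) : InWedge θ α (u + t • viewDir α) := by
  have h1 : ‖u + t • viewDir α‖ ≤ ‖u‖ + t := by
    refine (norm_add_le _ _).trans ?_
    rw [norm_smul, norm_viewDir, mul_one, Real.norm_of_nonneg ht]
  have h2 : 0 ≤ Real.cos (θ / 2) := Real.cos_nonneg_of_mem_Icc ⟨by linarith, by linarith⟩
  have h3 := Real.cos_le_one (θ / 2)
  have h4 : inner ℝ (viewDir α) (viewDir α) = (1 : ℝ) := by
    rw [inner_viewDir, sub_self, Real.cos_zero]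
  unfold InWedge at *
  rw [inner_add_right, real_inner_smul_right, h4]
  nlinarith [mul_le_mul_of_nonneg_right h1 h2]

/-- Since `cos (θ / 2) ≥ 0`, the condition bounds a convex function by a linear one. -/
theorem convex_inWedge {θ α : ℝ} (h0 : 0 < θ) (hpi : θ < Real.pi) :
    Convex ℝ {u | InWedge θ α u} := by
  have h2 : 0 ≤ Real.cos (θ / 2) := Real.cos_nonneg_of_mem_Icc ⟨by linarith, by linarith⟩
  intro u hu v hv s t hs ht hst
  have h1 : ‖s • u + t • v‖ ≤ s * ‖u‖ + t * ‖v‖ := by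
    refine (norm_add_le _ _).trans ?_
    rw [norm_smul, norm_smul, Real.norm_of_nonneg hs, Real.norm_of_nonneg ht]
  simp only [Set.mem_ofPred_eq, InWedge] at *
  rw [inner_add_right, real_inner_smul_right, real_inner_smul_right]
  nlinarith [mul_le_mul_of_nonneg_right h1 h2, mul_le_mul_of_nonneg_left hu hs,
    mul_le_mul_of_nonneg_left hv ht]

/-! ### Angle conditions in terms of signs -/

/-- The two dimensional cross product. -/
def cross (u v : Plane) : ℝ := u 0 * v 1 - u 1 * v 0

theorem inner_sq_add_cross_sq (u v : Plane) :
    inner ℝ u v ^ 2 + cross u v ^ 2 = (‖u‖ * ‖v‖) ^ 2 := by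
  rw [mul_pow, Plane.norm_sq_eq, Plane.norm_sq_eq, Plane.inner_eq, cross]
  ring

/-- If `b ∈ (-π, π]` is the oriented angle from `u` to `v`, the two combinations are `‖u‖ ‖v‖ sin (θ
- b)` and `‖u‖ ‖v‖ sin (θ + b)`, and the sign of the cross product tells whether `b` or `-b` is to
be compared with `θ`. In this form no norms occur: with `u = p - x` and `v = q - x`, all expressions
are lines or circles in `x`. -/
theorem angleLE_iff_sign {θ : ℝ} (h0 : 0 < θ) (hpi : θ < Real.pi) (u v : Plane) :
    AngleLE θ u v ↔
      (0 ≤ cross u v → 0 ≤ Real.sin θ * inner ℝ u v - Real.cos θ * cross u v) ∧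
      (cross u v ≤ 0 → 0 ≤ Real.sin θ * inner ℝ u v + Real.cos θ * cross u v) := by
  by_cases hu0 : u = 0
  · simp [AngleLE, hu0, cross]
  by_cases hv0 : v = 0
  · simp [AngleLE, hv0, cross]
  obtain ⟨a, -, -, hap⟩ := exists_polar 0 u
  obtain ⟨b, hb1, hb2, hbp⟩ := exists_polar a v
  rw [zero_add] at hap
  have hap' : u = ‖u‖ • viewDir (a + 0) := by rwa [add_zero]
  rw [angleLE_polar hap' hbp hu0 hv0, zero_sub, Real.cos_neg]
  have hpos : 0 < ‖u‖ * ‖v‖ := mul_pos (norm_pos_iff.2 hu0) (norm_pos_iff.2 hv0)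
  have hin : inner ℝ u v = ‖u‖ * ‖v‖ * Real.cos b := by
    conv_lhs => rw [hap, hbp]
    rw [real_inner_smul_right, real_inner_smul_left, inner_viewDir]
    have : a - (a + b) = -b := by ring
    rw [this, Real.cos_neg]
    ring
  have hcr : cross u v = ‖u‖ * ‖v‖ * Real.sin b := by
    conv_lhs => rw [hap, hbp]
    have : Real.sin b = Real.sin (a + b - a) := by congr 1; ring
    rw [this, Real.sin_sub]
    simp [cross, viewDir]
    ring
  have e1 : Real.sin θ * inner ℝ u v - Real.cos θ * cross u v
      = ‖u‖ * ‖v‖ * Real.sin (θ - b) := by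
    rw [hin, hcr, Real.sin_sub]; ring
  have e2 : Real.sin θ * inner ℝ u v + Real.cos θ * cross u v
      = ‖u‖ * ‖v‖ * Real.sin (θ + b) := by
    rw [hin, hcr, Real.sin_add]; ring
  rw [e1, e2, hcr]
  constructor
  · intro h
    have hb := abs_le.1 (abs_le_of_cos_le_cos (abs_le.2 ⟨hb1.le, hb2⟩) h0.le h)
    refine ⟨fun hs => mul_nonneg hpos.le ?_, fun hs => mul_nonneg hpos.le ?_⟩
    · have hb0 : 0 ≤ b := by
        by_contra! hlt
        have := Real.sin_neg_of_neg_of_neg_pi_lt hlt hb1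
        exact absurd (mul_neg_of_pos_of_neg hpos this) (not_lt.2 hs)
      exact Real.sin_nonneg_of_nonneg_of_le_pi (by linarith) (by linarith)
    · have hb0 : b ≤ 0 := by
        by_contra! hlt
        have := Real.sin_pos_of_pos_of_lt_pi hlt (by linarith)
        exact absurd (mul_pos hpos this) (not_lt.2 hs)
      exact Real.sin_nonneg_of_nonneg_of_le_pi (by linarith) (by linarith)
  · rintro ⟨hp, hn⟩
    apply cos_le_cos_of_abs_le_pi hpi.le
    rcases le_total 0 b with hb | hb
    · rw [abs_of_nonneg hb]
      by_contra! hlt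
      have h1 := hp (mul_nonneg hpos.le (Real.sin_nonneg_of_nonneg_of_le_pi hb hb2))
      have h2 := Real.sin_neg_of_neg_of_neg_pi_lt (x := θ - b) (by linarith) (by linarith)
      exact absurd (mul_neg_of_pos_of_neg hpos h2) (not_lt.2 h1)
    · rw [abs_of_nonpos hb]
      by_contra! hlt
      have h1 := hn (mul_nonpos_of_nonneg_of_nonpos hpos.le
        (Real.sin_nonpos_of_nonpos_of_neg_pi_le hb hb1.le))
      have h2 := Real.sin_neg_of_neg_of_neg_pi_lt (x := θ + b) (by linarith) (by linarith)
      exact absurd (mul_neg_of_pos_of_neg hpos h2) (not_lt.2 h1)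

/-- For `ε = ±1`, the equation of the two circles in which the chord `pq` has inscribed
angle `θ`. -/
noncomputable def aovFun (θ ε : ℝ) (p q x : Plane) : ℝ :=
  Real.sin θ * inner ℝ (p - x) (q - x) - ε * Real.cos θ * cross (p - x) (q - x)

theorem continuous_cross_sub (p q : Plane) : Continuous fun x => cross (p - x) (q - x) := by
  unfold cross
  fun_prop

/-- An angle condition holding at `z` persists near `z`, or holds near `z` on one of the circles
with inscribed angle `θ`, which passes through `z`. -/
theorem AngleLE.eventually {θ : ℝ} (h0 : 0 < θ) (hpi : θ < Real.pi) {p q z : Plane}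
    (hp : p ≠ z) (hq : q ≠ z) (h : AngleLE θ (p - z) (q - z)) :
    (∀ᶠ w in 𝓝 z, AngleLE θ (p - w) (q - w)) ∨
      ∃ ε : ℝ, (ε = 1 ∨ ε = -1) ∧ aovFun θ ε p q z = 0 ∧
        ∀ᶠ w in 𝓝 z, aovFun θ ε p q w = 0 → AngleLE θ (p - w) (q - w) := by
  have hsin : 0 < Real.sin θ := Real.sin_pos_of_pos_of_lt_pi h0 hpi
  rcases lt_or_eq_of_le h with hlt | heq
  · left
    have hc : Continuous fun w : Plane =>
        inner ℝ (p - w) (q - w) - Real.cos θ * (‖p - w‖ * ‖q - w‖) := by fun_prop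
    filter_upwards [hc.continuousAt.eventually_const_lt (sub_pos.2 hlt)] with w hw
    exact (sub_pos.1 hw).le
  · right
    set R := ‖p - z‖ * ‖q - z‖
    have hR : 0 < R := mul_pos (norm_pos_iff.2 (sub_ne_zero.2 hp))
      (norm_pos_iff.2 (sub_ne_zero.2 hq))
    have hsq := inner_sq_add_cross_sq (p - z) (q - z)
    -- Equality in the angle condition forces the cross product to be `± sin θ * R`. Its sign
    -- selects the circle through `z` and is stable near `z`; on that circle the relevant condition
    -- of `angleLE_iff_sign` holds with equality.
    have hfac : (cross (p - z) (q - z) - Real.sin θ * R) *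
        (cross (p - z) (q - z) + Real.sin θ * R) = 0 := by
      rw [← heq] at hsq
      linear_combination hsq - R ^ 2 * Real.sin_sq_add_cos_sq θ
    have hcont := (continuous_cross_sub p q).continuousAt (x := z)
    rcases mul_eq_zero.1 hfac with hx | hx
    · have hx' : cross (p - z) (q - z) = Real.sin θ * R := by linarith
      refine ⟨1, Or.inl rfl, ?_, ?_⟩
      · rw [aovFun, ← heq, hx']
        ring
      · have hpos : 0 < cross (p - z) (q - z) := by rw [hx']; positivity
        filter_upwards [hcont.eventually_const_lt hpos] with w hw hz
        rw [aovFun] at hz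
        rw [angleLE_iff_sign h0 hpi]
        exact ⟨fun _ => by linarith, fun h => absurd hw (not_lt.2 h)⟩
    · have hx' : cross (p - z) (q - z) = -(Real.sin θ * R) := by linarith
      refine ⟨-1, Or.inr rfl, ?_, ?_⟩
      · rw [aovFun, ← heq, hx']
        ring
      · have hneg : cross (p - z) (q - z) < 0 := by rw [hx']; linarith [mul_pos hsin hR]
        filter_upwards [hcont.eventually_lt_const hneg] with w hw hz
        rw [aovFun] at hz
        rw [angleLE_iff_sign h0 hpi]
        exact ⟨fun h => absurd hw (not_lt.2 h), fun _ => by linarith⟩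

/-! ### Circles of inscribed angle -/

theorem Plane.dist_sq_eq (p q : Plane) : dist p q ^ 2 = (p 0 - q 0) ^ 2 + (p 1 - q 1) ^ 2 := by
  rw [dist_eq_norm, Plane.norm_sq_eq]
  simp

/-- The centre of the circle with equation `aovFun θ ε p q`. -/
noncomputable def aovCenter (θ ε : ℝ) (p q : Plane) : Plane :=
  !₂[(p 0 + q 0) / 2 + ε * (Real.cos θ / Real.sin θ) / 2 * (p 1 - q 1),
    (p 1 + q 1) / 2 - ε * (Real.cos θ / Real.sin θ) / 2 * (p 0 - q 0)]

theorem aovFun_eq {θ ε : ℝ} (hs : 0 < Real.sin θ) (hε : ε = 1 ∨ ε = -1) (p q x : Plane) :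
    aovFun θ ε p q x = Real.sin θ * ((x 0 - aovCenter θ ε p q 0) ^ 2 +
      (x 1 - aovCenter θ ε p q 1) ^ 2 - (dist p q / (2 * Real.sin θ)) ^ 2) := by
  have hε2 : ε ^ 2 = 1 := by rcases hε with h | h <;> simp [h]
  have h1 := Real.sin_sq_add_cos_sq θ
  have hd := Plane.dist_sq_eq p q
  rw [div_pow, hd]
  simp [aovFun, aovCenter, Plane.inner_eq, cross]
  field_simp
  linear_combination (-ε ^ 2 * ((p 0 - q 0) ^ 2 + (p 1 - q 1) ^ 2)) * h1 -
    ((p 0 - q 0) ^ 2 + (p 1 - q 1) ^ 2) * (1 - Real.sin θ ^ 2) * hε2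

theorem setOf_aovFun_eq {θ ε : ℝ} (hs : 0 < Real.sin θ) (hε : ε = 1 ∨ ε = -1) (p q : Plane) :
    {x | aovFun θ ε p q x = 0} =
      Metric.sphere (aovCenter θ ε p q) (dist p q / (2 * Real.sin θ)) := by
  ext x
  rw [Plane.mem_sphere_iff _ _ (by positivity), Set.mem_ofPred_eq, aovFun_eq hs hε]
  simp [hs.ne']

theorem aovFun_left (θ ε : ℝ) (p q : Plane) : aovFun θ ε p q p = 0 := by
  simp [aovFun, cross]

theorem aovFun_right (θ ε : ℝ) (p q : Plane) : aovFun θ ε p q q = 0 := by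
  simp [aovFun, cross]

theorem isCurveFun_aovFun {θ ε : ℝ} (hs : 0 < Real.sin θ) (hε : ε = 1 ∨ ε = -1) {p q : Plane}
    (hpq : p ≠ q) : ∃ g, IsCurveFun g ∧ aovFun θ ε p q = Real.sin θ • g :=
  ⟨_, Or.inr ⟨_, _, _, div_pos (dist_pos.2 hpq) (by positivity), fun _ => rfl⟩,
    funext fun x => aovFun_eq hs hε p q x⟩

theorem isQuad_aovFun (θ ε : ℝ) (p q : Plane) : IsQuad (aovFun θ ε p q) :=
  ⟨Real.sin θ, -Real.sin θ * (p 0 + q 0) - ε * Real.cos θ * (p 1 - q 1),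
    -Real.sin θ * (p 1 + q 1) + ε * Real.cos θ * (p 0 - q 0),
    Real.sin θ * (p 0 * q 0 + p 1 * q 1) - ε * Real.cos θ * (p 0 * q 1 - p 1 * q 0), fun x => by
      simp [aovFun, cross, Plane.inner_eq]; ring⟩

/-- A circle through `p` and `q` of radius `|pq| / (2 sin θ)` is one of two circles. -/
theorem sphere_eq_setOf_aovFun {θ : ℝ} (hs : 0 < Real.sin θ) {p q c : Plane} (hpq : p ≠ q)
    (hp : p ∈ Metric.sphere c (dist p q / (2 * Real.sin θ)))
    (hq : q ∈ Metric.sphere c (dist p q / (2 * Real.sin θ))) :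
    ∃ ε : ℝ, (ε = 1 ∨ ε = -1) ∧
      Metric.sphere c (dist p q / (2 * Real.sin θ)) = {x | aovFun θ ε p q x = 0} := by
  rw [Plane.mem_sphere_iff _ _ (by positivity), div_pow, Plane.dist_sq_eq] at hp hq
  have h1 := Real.sin_sq_add_cos_sq θ
  set k := Real.cos θ / Real.sin θ with hk
  set d0 := p 0 - q 0 with hd0
  set d1 := p 1 - q 1 with hd1
  have hD : 0 < d0 ^ 2 + d1 ^ 2 := by
    rw [← Plane.dist_sq_eq]
    exact pow_pos (dist_pos.2 hpq) 2
  have hrad : (d0 ^ 2 + d1 ^ 2) / (2 * Real.sin θ) ^ 2 = (d0 ^ 2 + d1 ^ 2) * (1 + k ^ 2) / 4 := by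
    rw [hk]
    field_simp
    linear_combination (-4) * h1
  rw [hrad] at hp hq
  -- The centre lies on the perpendicular bisector; `s` is its signed offset from the midpoint in
  -- units of the chord. The radius forces `s = ± cot θ / 2`.
  set s := ((c 0 - (p 0 + q 0) / 2) * d1 - (c 1 - (p 1 + q 1) / 2) * d0) / (d0 ^ 2 + d1 ^ 2)
    with hsdef
  have horth : (c 0 - (p 0 + q 0) / 2) * d0 + (c 1 - (p 1 + q 1) / 2) * d1 = 0 := by
    linear_combination (hq - hp) / 2
  have hc0 : c 0 = (p 0 + q 0) / 2 + s * d1 := by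
    rw [hsdef]
    field_simp
    linear_combination 2 * d0 * horth
  have hc1 : c 1 = (p 1 + q 1) / 2 - s * d0 := by
    rw [hsdef]
    field_simp
    linear_combination 2 * d1 * horth
  have hsk : (s - k / 2) * (s + k / 2) = 0 := by
    apply mul_left_cancel₀ hD.ne'
    rw [hc0, hc1] at hp
    linear_combination hp
  rcases mul_eq_zero.1 hsk with h | h
  · refine ⟨1, Or.inl rfl, ?_⟩
    rw [setOf_aovFun_eq hs (Or.inl rfl)]
    congr 1
    have : s = k / 2 := by linarith
    refine Plane.ext ?_ ?_
    · rw [hc0, this]; simp [aovCenter, hk, hd1]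
    · rw [hc1, this]; simp [aovCenter, hk, hd0]
  · refine ⟨-1, Or.inr rfl, ?_⟩
    rw [setOf_aovFun_eq hs (Or.inr rfl)]
    congr 1
    have : s = -(k / 2) := by linarith
    refine Plane.ext ?_ ?_
    · rw [hc0, this]; simp [aovCenter]; ring
    · rw [hc1, this]; simp [aovCenter]; ring

/-! ### Occlusion of a triangle by a segment -/

/-- Twice the signed area of the triangle `pqx`. -/
def orient3 (p q x : Plane) : ℝ := (q 0 - p 0) * (x 1 - p 1) - (q 1 - p 1) * (x 0 - p 0)

/-- Divided by `orient3 s e x`, the three signed areas are the barycentric coordinates of `y` in the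
triangle; both sides say that all of them are positive. -/
theorem exists_mem_openSegment_iff {s e x y : Plane} (hO : 0 < orient3 s e x) :
    (∃ p ∈ openSegment ℝ s e, y ∈ openSegment ℝ x p) ↔
      0 < orient3 s e y ∧ 0 < orient3 e x y ∧ 0 < orient3 x s y := by
  constructor
  · rintro ⟨p, ⟨a, b, ha, hb, hab, rfl⟩, c, d, hc, hd, hcd, rfl⟩
    obtain rfl : b = 1 - a := by linarith
    obtain rfl : d = 1 - c := by linarith
    have e1 : orient3 s e (c • x + (1 - c) • (a • s + (1 - a) • e)) = c * orient3 s e x := by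
      simp [orient3]; ring
    have e2 : orient3 e x (c • x + (1 - c) • (a • s + (1 - a) • e)) =
        (1 - c) * a * orient3 s e x := by
      simp [orient3]; ring
    have e3 : orient3 x s (c • x + (1 - c) • (a • s + (1 - a) • e)) =
        (1 - c) * (1 - a) * orient3 s e x := by
      simp [orient3]; ring
    rw [e1, e2, e3]
    exact ⟨by positivity, by positivity, by positivity⟩
  · rintro ⟨h1, h2, h3⟩
    set O := orient3 s e x with hOdef
    have hsum : orient3 s e y + orient3 e x y + orient3 x s y = O := by
      simp only [hOdef, orient3]; ring
    set A := orient3 e x y with hA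
    set B := orient3 x s y with hB
    set C := orient3 s e y with hC
    have hAB : 0 < A + B := by positivity
    refine ⟨(A / (A + B)) • s + (B / (A + B)) • e,
      ⟨A / (A + B), B / (A + B), by positivity, by positivity, by field_simp, rfl⟩,
      C / O, (A + B) / O, by positivity, by positivity, ?_, ?_⟩
    · field_simp
      linarith
    · have key0 : O * y 0 = A * s 0 + B * e 0 + C * x 0 := by
        simp only [hOdef, hA, hB, hC, orient3]; ring
      have key1 : O * y 1 = A * s 1 + B * e 1 + C * x 1 := by
        simp only [hOdef, hA, hB, hC, orient3]; ring
      apply Plane.ext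
      · simp
        field_simp
        linarith
      · simp
        field_simp
        linarith

/-- Where two affine functions on the unit interval, given by their end values, are both
positive. -/
theorem exists_both_pos_iff (A B C D : ℝ) :
    (∃ t : ℝ, (0 ≤ t ∧ t ≤ 1) ∧ 0 < (1 - t) * A + t * B ∧ 0 < (1 - t) * C + t * D) ↔
      (0 < A ∧ 0 < C) ∨ (0 < B ∧ 0 < D) ∨ (0 < A ∧ 0 < D ∧ 0 < A * D - B * C) ∨
        (0 < C ∧ 0 < B ∧ A * D - B * C < 0) := by
  constructor
  · rintro ⟨t, ⟨h0, h1⟩, hp, hq⟩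
    by_contra! hcon
    obtain ⟨c1, c2, c3, c4⟩ := hcon
    by_cases hA : 0 < A
    · have hC := c1 hA
      have hD : 0 < D := by
        by_contra! hD
        nlinarith [mul_nonneg h0 (neg_nonneg.2 hD),
          mul_nonneg (sub_nonneg.2 h1) (neg_nonneg.2 hC)]
      have hB : B ≤ 0 := by by_contra! hB; exact absurd (c2 hB) (not_le.2 hD)
      have h3 := c3 hA hD
      nlinarith [mul_pos hp hD, mul_nonneg (neg_nonneg.2 hB) hq.le,
        mul_nonneg (neg_nonneg.2 hC) hp.le, mul_pos hq hA]
    · push Not at hA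
      have hB : 0 < B := by
        by_contra! hB
        nlinarith [mul_nonneg h0 (neg_nonneg.2 hB),
          mul_nonneg (sub_nonneg.2 h1) (neg_nonneg.2 hA)]
      have hD := c2 hB
      have hC : 0 < C := by
        by_contra! hC
        nlinarith [mul_nonneg h0 (neg_nonneg.2 hD),
          mul_nonneg (sub_nonneg.2 h1) (neg_nonneg.2 hC)]
      have h4 := c4 hC hB
      nlinarith [mul_pos hp hC, mul_pos hq hB, mul_nonneg (neg_nonneg.2 hA) hq.le,
        mul_nonneg (neg_nonneg.2 hD) hp.le]
  · have main : ∀ A B C D : ℝ, 0 < A → 0 < D → B ≤ 0 → C ≤ 0 → 0 < A * D - B * C →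
        ∃ t : ℝ, (0 ≤ t ∧ t ≤ 1) ∧ 0 < (1 - t) * A + t * B ∧ 0 < (1 - t) * C + t * D := by
      intro A B C D hA hD hB hC h
      have hS : 0 < (A - C) + (D - B) := by linarith
      -- The parameter at which the two affine functions are equal; their common value has the sign
      -- of the determinant.
      refine ⟨(A - C) / ((A - C) + (D - B)), ⟨?_, ?_⟩, ?_, ?_⟩
      · exact div_nonneg (by linarith) hS.le
      · rw [div_le_one hS]; linarith
      · have : (1 - (A - C) / ((A - C) + (D - B))) * A + (A - C) / ((A - C) + (D - B)) * B
            = (A * D - B * C) / ((A - C) + (D - B)) := by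
          field_simp; ring
        rw [this]; positivity
      · have : (1 - (A - C) / ((A - C) + (D - B))) * C + (A - C) / ((A - C) + (D - B)) * D
            = (A * D - B * C) / ((A - C) + (D - B)) := by
          field_simp; ring
        rw [this]; positivity
    rintro (⟨hA, hC⟩ | ⟨hB, hD⟩ | ⟨hA, hD, h⟩ | ⟨hC, hB, h⟩)
    · exact ⟨0, by norm_num, by simpa using hA, by simpa using hC⟩
    · exact ⟨1, by norm_num, by simpa using hB, by simpa using hD⟩
    · by_cases hC : 0 < C
      · exact ⟨0, by norm_num, by simpa using hA, by simpa using hC⟩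
      by_cases hB : 0 < B
      · exact ⟨1, by norm_num, by simpa using hB, by simpa using hD⟩
      exact main A B C D hA hD (not_lt.1 hB) (not_lt.1 hC) h
    · by_cases hA : 0 < A
      · exact ⟨0, by norm_num, by simpa using hA, by simpa using hC⟩
      by_cases hD : 0 < D
      · exact ⟨1, by norm_num, by simpa using hB, by simpa using hD⟩
      obtain ⟨t, h1, h2, h3⟩ := main C D A B hC hB (not_lt.1 hD) (not_lt.1 hA) (by linarith)
      exact ⟨t, h1, h3, h2⟩

theorem pos_iff_of_sign_eq {a b : ℝ} (h : SignType.sign a = SignType.sign b) :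
    0 < a ↔ 0 < b := by
  rw [← sign_eq_one_iff, h, sign_eq_one_iff]

theorem neg_iff_of_sign_eq {a b : ℝ} (h : SignType.sign a = SignType.sign b) :
    a < 0 ↔ b < 0 := by
  rw [← sign_eq_neg_one_iff, h, sign_eq_neg_one_iff]

theorem nonneg_iff_of_sign_eq {a b : ℝ} (h : SignType.sign a = SignType.sign b) :
    0 ≤ a ↔ 0 ≤ b := by
  rw [← not_lt, neg_iff_of_sign_eq h, not_lt]

theorem nonpos_iff_of_sign_eq {a b : ℝ} (h : SignType.sign a = SignType.sign b) :
    a ≤ 0 ↔ b ≤ 0 := by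
  rw [← not_lt, pos_iff_of_sign_eq h, not_lt]

theorem exists_both_pos_of_sign_eq {A B C D A' B' C' D' : ℝ}
    (hA : SignType.sign A = SignType.sign A') (hB : SignType.sign B = SignType.sign B')
    (hC : SignType.sign C = SignType.sign C') (hD : SignType.sign D = SignType.sign D')
    (hdet : SignType.sign (A * D - B * C) = SignType.sign (A' * D' - B' * C'))
    (h : ∃ t : ℝ, (0 ≤ t ∧ t ≤ 1) ∧ 0 < (1 - t) * A + t * B ∧ 0 < (1 - t) * C + t * D) :
    ∃ t : ℝ, (0 ≤ t ∧ t ≤ 1) ∧ 0 < (1 - t) * A' + t * B' ∧ 0 < (1 - t) * C' + t * D' := by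
  rw [exists_both_pos_iff] at h ⊢
  rwa [pos_iff_of_sign_eq hA, pos_iff_of_sign_eq hB, pos_iff_of_sign_eq hC,
    pos_iff_of_sign_eq hD, pos_iff_of_sign_eq hdet, neg_iff_of_sign_eq hdet] at h

/-- Three convex subsets of the line that meet pairwise have a common point. -/
theorem exists_common_of_pairwise {S₁ S₂ S₃ : Set ℝ} (h₁ : Convex ℝ S₁) (h₂ : Convex ℝ S₂)
    (h₃ : Convex ℝ S₃) (h₁₂ : (S₁ ∩ S₂).Nonempty) (h₁₃ : (S₁ ∩ S₃).Nonempty)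
    (h₂₃ : (S₂ ∩ S₃).Nonempty) : (S₁ ∩ S₂ ∩ S₃).Nonempty := by
  obtain ⟨a, ha1, ha2⟩ := h₁₂
  obtain ⟨b, hb1, hb3⟩ := h₁₃
  obtain ⟨c, hc2, hc3⟩ := h₂₃
  have o₁ := h₁.ordConnected
  have o₂ := h₂.ordConnected
  have o₃ := h₃.ordConnected
  by_cases hab : a ≤ b
  · by_cases hbc : b ≤ c
    · exact ⟨b, ⟨hb1, o₂.out ha2 hc2 ⟨hab, hbc⟩⟩, hb3⟩
    · push Not at hbc
      by_cases hac : a ≤ c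
      · exact ⟨c, ⟨o₁.out ha1 hb1 ⟨hac, hbc.le⟩, hc2⟩, hc3⟩
      · push Not at hac
        exact ⟨a, ⟨ha1, ha2⟩, o₃.out hc3 hb3 ⟨hac.le, hab⟩⟩
  · push Not at hab
    by_cases hbc : c ≤ b
    · exact ⟨b, ⟨hb1, o₂.out hc2 ha2 ⟨hbc, hab.le⟩⟩, hb3⟩
    · push Not at hbc
      by_cases hac : c ≤ a
      · exact ⟨c, ⟨o₁.out hb1 ha1 ⟨hbc.le, hac⟩, hc2⟩, hc3⟩
      · push Not at hac
        exact ⟨a, ⟨ha1, ha2⟩, o₃.out hb3 hc3 ⟨hab.le, hac.le⟩⟩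

/-- The locations from which the segment `ab` occludes the segment `se`. -/
def blocked (s e a b : Plane) : Set Plane :=
  {x | ∃ y ∈ segment ℝ a b, ∃ p ∈ openSegment ℝ s e, y ∈ openSegment ℝ x p}

theorem blocked_swap (s e a b : Plane) : blocked e s a b = blocked s e a b := by
  simp only [blocked, openSegment_symm ℝ e s]

theorem convex_affine_pos (A B : ℝ) :
    Convex ℝ {t : ℝ | (0 ≤ t ∧ t ≤ 1) ∧ 0 < (1 - t) * A + t * B} := by
  rintro t ⟨⟨h1, h2⟩, h3⟩ t' ⟨⟨h1', h2'⟩, h3'⟩ c d hc hd hcd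
  obtain rfl : d = 1 - c := by linarith
  refine ⟨⟨by simp only [smul_eq_mul]; positivity, ?_⟩, ?_⟩
  · simp only [smul_eq_mul]
    nlinarith [mul_nonneg hc (sub_nonneg.2 h2), mul_nonneg hd (sub_nonneg.2 h2')]
  · have : (1 - (c • t + (1 - c) • t')) * A + (c • t + (1 - c) • t') * B =
        c * ((1 - t) * A + t * B) + (1 - c) * ((1 - t') * A + t' * B) := by
      simp only [smul_eq_mul]; ring
    rw [this]
    rcases hc.eq_or_lt with rfl | hc'
    · simpa using h3'
    · have := mul_pos hc' h3
      have := mul_nonneg hd h3'.le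
      linarith

theorem mem_blocked_iff {s e a b x : Plane} (hO : 0 < orient3 s e x) :
    x ∈ blocked s e a b ↔ ∃ t : ℝ, (0 ≤ t ∧ t ≤ 1) ∧
      0 < (1 - t) * orient3 s e a + t * orient3 s e b ∧
      0 < (1 - t) * orient3 e x a + t * orient3 e x b ∧
      0 < (1 - t) * orient3 x s a + t * orient3 x s b := by
  have key : ∀ (p q : Plane) (t : ℝ), orient3 p q ((1 - t) • a + t • b) =
      (1 - t) * orient3 p q a + t * orient3 p q b := by
    intro p q t
    simp [orient3]; ring
  constructor
  · rintro ⟨y, ⟨c, t, hc, ht, hct, rfl⟩, hy⟩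
    obtain rfl : c = 1 - t := by linarith
    rw [exists_mem_openSegment_iff hO, key, key, key] at hy
    exact ⟨t, ⟨ht, by linarith⟩, hy⟩
  · rintro ⟨t, ⟨h0, h1⟩, hy⟩
    refine ⟨(1 - t) • a + t • b, ⟨1 - t, t, by linarith, h0, by ring, rfl⟩, ?_⟩
    rw [exists_mem_openSegment_iff hO, key, key, key]
    exact hy

/-- Along `ab` the three barycentric coordinates are affine in the parameter, and blocking means
that they are positive simultaneously. By Helly's theorem on the line it suffices to treat two at a
time, and each pair is decided by the signs of the end values and of a 2×2 determinant. Each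
determinant is `orient3 s e x > 0` times a constant or times `orient3 a b x`, so only signs of
affine functions of `x` enter. -/
theorem mem_blocked_of_sign_eq {s e a b x x' : Plane} (hO : 0 < orient3 s e x)
    (hO' : 0 < orient3 s e x')
    (h1 : SignType.sign (orient3 e x a) = SignType.sign (orient3 e x' a))
    (h2 : SignType.sign (orient3 e x b) = SignType.sign (orient3 e x' b))
    (h3 : SignType.sign (orient3 x s a) = SignType.sign (orient3 x' s a))
    (h4 : SignType.sign (orient3 x s b) = SignType.sign (orient3 x' s b))
    (h5 : SignType.sign (orient3 a b x) = SignType.sign (orient3 a b x'))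
    (h : x ∈ blocked s e a b) : x' ∈ blocked s e a b := by
  have d12 : ∀ x, orient3 s e a * orient3 e x b - orient3 s e b * orient3 e x a =
      orient3 s e x * orient3 e a b := by
    intro x; simp only [orient3]; ring
  have d13 : ∀ x, orient3 s e a * orient3 x s b - orient3 s e b * orient3 x s a =
      orient3 s e x * -orient3 s a b := by
    intro x; simp only [orient3]; ring
  have d23 : ∀ x, orient3 e x a * orient3 x s b - orient3 e x b * orient3 x s a =
      orient3 s e x * orient3 a b x := by
    intro x; simp only [orient3]; ring
  rw [mem_blocked_iff hO] at h
  rw [mem_blocked_iff hO']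
  obtain ⟨t, ht, t1, t2, t3⟩ := h
  obtain ⟨r, ⟨⟨hr, r1⟩, -, r2⟩, -, r3⟩ := exists_common_of_pairwise
    (convex_affine_pos (orient3 s e a) (orient3 s e b))
    (convex_affine_pos (orient3 e x' a) (orient3 e x' b))
    (convex_affine_pos (orient3 x' s a) (orient3 x' s b))
    (by
      obtain ⟨r, hr, k1, k2⟩ := exists_both_pos_of_sign_eq rfl rfl h1 h2
        (by rw [d12, d12, sign_mul, sign_mul, sign_pos hO, sign_pos hO']) ⟨t, ht, t1, t2⟩
      exact ⟨r, ⟨hr, k1⟩, hr, k2⟩)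
    (by
      obtain ⟨r, hr, k1, k2⟩ := exists_both_pos_of_sign_eq rfl rfl h3 h4
        (by rw [d13, d13, sign_mul, sign_mul, sign_pos hO, sign_pos hO']) ⟨t, ht, t1, t3⟩
      exact ⟨r, ⟨hr, k1⟩, hr, k2⟩)
    (by
      obtain ⟨r, hr, k1, k2⟩ := exists_both_pos_of_sign_eq h1 h2 h3 h4
        (by rw [d23, d23, sign_mul, sign_mul, sign_pos hO, sign_pos hO', h5]) ⟨t, ht, t2, t3⟩
      exact ⟨r, ⟨hr, k1⟩, hr, k2⟩)
  exact ⟨r, hr, r1, r2, r3⟩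

/-! ### Distance to a segment -/

/-- By Pythagoras the squared distance to the point with parameter `t`, times `L ^ 2`, is `orient3 s
e x ^ 2 + (k - t L ^ 2) ^ 2`. If the foot of the perpendicular is on the segment the height decides,
otherwise an end point is nearest. Everything is phrased through signs of lines and circles. -/
theorem forall_le_dist_iff {s e : Plane} (hse : s ≠ e) {R : ℝ} (hR : 0 ≤ R) (x : Plane) :
    (∀ p ∈ segment ℝ s e, R ≤ dist x p) ↔
      0 ≤ dist x s ^ 2 - R ^ 2 ∧ 0 ≤ dist x e ^ 2 - R ^ 2 ∧
      (0 ≤ inner ℝ (x - s) (e - s) → 0 ≤ inner ℝ (e - x) (e - s) →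
        0 ≤ orient3 s e x - R * dist s e ∨ orient3 s e x + R * dist s e ≤ 0) := by
  have hL : 0 < dist s e := dist_pos.2 hse
  have hL2 := Plane.dist_sq_eq s e
  set L := dist s e
  have hle : ∀ p, R ≤ dist x p ↔ 0 ≤ dist x p ^ 2 - R ^ 2 := fun p => by
    rw [sub_nonneg, sq_le_sq₀ hR dist_nonneg]
  have hexp : ∀ t : ℝ, dist x ((1 - t) • s + t • e) ^ 2 * L ^ 2 =
      orient3 s e x ^ 2 + (inner ℝ (x - s) (e - s) - t * L ^ 2) ^ 2 := by
    intro t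
    rw [Plane.dist_sq_eq, hL2, Plane.inner_eq]
    simp [orient3]
    ring
  have hsum : inner ℝ (x - s) (e - s) + inner ℝ (e - x) (e - s) = L ^ 2 := by
    rw [hL2, Plane.inner_eq, Plane.inner_eq]
    simp
    ring
  constructor
  · intro h
    refine ⟨(hle s).1 (h s (left_mem_segment ℝ s e)), (hle e).1 (h e (right_mem_segment ℝ s e)),
      fun h1 h2 => ?_⟩
    set k := inner ℝ (x - s) (e - s)
    have h3 := (hle _).1 (h ((1 - k / L ^ 2) • s + (k / L ^ 2) • e)
      ⟨1 - k / L ^ 2, k / L ^ 2, by rw [sub_nonneg, div_le_one (by positivity)]; linarith,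
        by positivity, by ring, rfl⟩)
    have h4 := hexp (k / L ^ 2)
    rw [div_mul_cancel₀ _ (by positivity), sub_self] at h4
    have h5 : (R * L) ^ 2 ≤ orient3 s e x ^ 2 := by
      rw [mul_pow]
      nlinarith [mul_nonneg h3 (sq_nonneg L)]
    rcases le_abs.1 ((le_abs_self _).trans (sq_le_sq.1 h5)) with h6 | h6
    · left; linarith
    · right; linarith
  · rintro ⟨h1, h2, h3⟩ p ⟨c, t, hc, ht, hct, rfl⟩
    obtain rfl : c = 1 - t := by linarith
    rw [hle]
    set k := inner ℝ (x - s) (e - s)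
    have es := hexp 0
    have ee := hexp 1
    simp only [sub_zero, one_smul, zero_smul, add_zero, zero_mul, sub_self, zero_add, one_mul]
      at es ee
    have ht' := hexp t
    rw [← mul_nonneg_iff_of_pos_right (pow_pos hL 2), sub_mul] at h1 h2 ⊢
    rw [es] at h1
    rw [ee] at h2
    rw [ht']
    have hL2p := pow_pos hL 2
    rcases lt_or_ge k 0 with hk | hk
    · nlinarith [mul_nonneg ht hL2p.le, mul_nonneg (mul_nonneg ht hL2p.le) (neg_nonneg.2 hk.le),
        sq_nonneg (t * L ^ 2)]
    rcases lt_or_ge (inner ℝ (e - x) (e - s)) 0 with hk' | hk'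
    · have h6 : 0 ≤ (1 - t) * L ^ 2 := mul_nonneg hc hL2p.le
      nlinarith [mul_nonneg h6 (neg_nonneg.2 hk'.le), sq_nonneg ((1 - t) * L ^ 2)]
    have hRL : 0 ≤ R * L := by positivity
    rcases h3 hk hk' with h | h <;>
      nlinarith [sq_nonneg (k - t * L ^ 2)]

/-! ### The camera placement field of a target is cut out by lines and circles -/

theorem orient3_swap (s e x : Plane) : orient3 e s x = -orient3 s e x := by
  simp only [orient3]; ring

theorem cross_sub_eq_orient3 (s e x : Plane) : cross (s - x) (e - x) = orient3 s e x := by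
  simp [cross, orient3]; ring

namespace OLSTarget

/-- The signed height over the line of a target, positive in front of the target. -/
noncomputable def front (T : OLSTarget) (x : Plane) : ℝ :=
  inner ℝ T.orient (x - midpoint ℝ T.start T.finish)

theorem front_eq (T : OLSTarget) (x : Plane) :
    T.front x = inner ℝ T.orient (x - T.start) := by
  have h := T.orient_perp
  rw [front, midpoint_eq_smul_add]
  rw [Plane.inner_eq] at h ⊢
  rw [Plane.inner_eq]
  simp at h ⊢
  linear_combination (-1 / 2) * h

theorem continuous_front (T : OLSTarget) : Continuous T.front := by
  unfold front
  fun_prop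

theorem exists_front_eq_mul (T : OLSTarget) :
    ∃ l : ℝ, l ≠ 0 ∧ ∀ x, T.front x = l * orient3 T.start T.finish x := by
  set d0 := T.finish 0 - T.start 0 with hd0
  set d1 := T.finish 1 - T.start 1 with hd1
  have hD : 0 < d0 ^ 2 + d1 ^ 2 := by
    rw [hd0, hd1, ← Plane.dist_sq_eq]
    exact pow_pos (dist_pos.2 T.start_ne_finish.symm) 2
  have hperp : T.orient 0 * d0 + T.orient 1 * d1 = 0 := by
    have h := T.orient_perp
    rw [Plane.inner_eq] at h
    simpa using h
  have e0 : T.orient 0 = (T.orient 1 * d0 - T.orient 0 * d1) / (d0 ^ 2 + d1 ^ 2) * (-d1) := by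
    field_simp
    linear_combination d0 * hperp
  have e1 : T.orient 1 = (T.orient 1 * d0 - T.orient 0 * d1) / (d0 ^ 2 + d1 ^ 2) * d0 := by
    field_simp
    linear_combination d1 * hperp
  refine ⟨(T.orient 1 * d0 - T.orient 0 * d1) / (d0 ^ 2 + d1 ^ 2), ?_, fun x => ?_⟩
  · intro h0
    rw [h0, zero_mul] at e0 e1
    exact T.orient_ne_zero (Plane.ext e0 e1)
  · rw [front_eq, Plane.inner_eq]
    generalize (T.orient 1 * d0 - T.orient 0 * d1) / (d0 ^ 2 + d1 ^ 2) = l at e0 e1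
    rw [e0, e1]
    simp [orient3, hd0, hd1]
    ring

theorem angle_lt_iff (T : OLSTarget) (x : Plane) :
    InnerProductGeometry.angle T.orient (x - midpoint ℝ T.start T.finish) < Real.pi / 2 ↔
      0 < T.front x := by
  have hx : ∀ u v : Plane, InnerProductGeometry.angle u v < Real.pi / 2 ↔ 0 < inner ℝ u v := by
    intro u v
    rw [InnerProductGeometry.angle, Real.arccos_lt_pi_div_two]
    by_cases hu : u = 0
    · simp [hu]
    by_cases hv : v = 0
    · simp [hv]
    exact div_pos_iff_of_pos_right (mul_pos (norm_pos_iff.2 hu) (norm_pos_iff.2 hv))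
  exact hx _ _

end OLSTarget

namespace OLSC

variable {n u : ℕ}

theorem sin_θ_pos (I : OLSC n u) : 0 < Real.sin I.θ :=
  Real.sin_pos_of_pos_of_lt_pi I.θ_pos I.θ_lt_pi

/-- The segments that may occlude target `i`. -/
def occSegs (I : OLSC n u) (i : Fin n) : Set (Plane × Plane) :=
  {σ | (∃ j, j ≠ i ∧ σ = ((I.target j).start, (I.target j).finish)) ∨ ∃ k, σ ∈ I.obstacle k}

theorem finite_occSegs (I : OLSC n u) (i : Fin n) : (I.occSegs i).Finite := by
  have h : I.occSegs i ⊆ Set.range (fun j => ((I.target j).start, (I.target j).finish)) ∪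
      ⋃ k, {σ | σ ∈ I.obstacle k} := by
    rintro σ (⟨j, -, rfl⟩ | ⟨k, hk⟩)
    · exact Or.inl ⟨j, rfl⟩
    · exact Or.inr (Set.mem_iUnion.2 ⟨k, hk⟩)
  exact ((Set.finite_range _).union (Set.finite_iUnion fun k => List.finite_toSet _)).subset h

theorem strictFrontalView_iff (I : OLSC n u) (i : Fin n) (x : Plane) :
    I.StrictFrontalView i x ↔ 0 < (I.target i).front x ∧
      ∀ σ ∈ I.occSegs i, x ∉ blocked (I.target i).start (I.target i).finish σ.1 σ.2 := by
  rw [StrictFrontalView, OLSTarget.angle_lt_iff]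
  refine and_congr_right fun _ => ⟨?_, ?_⟩
  · rintro h σ hσ ⟨y, hy, p, hp, hyp⟩
    refine Set.disjoint_left.1 (h p hp) hyp ?_
    rcases hσ with ⟨j, hj, rfl⟩ | ⟨k, hk⟩
    · exact Or.inl ⟨j, hj, hy⟩
    · exact Or.inr ⟨k, σ, hk, hy⟩
  · intro h p hp
    refine Set.disjoint_left.2 fun y hyp hy => ?_
    rcases hy with ⟨j, hj, hy⟩ | ⟨k, σ, hk, hy⟩
    · exact h _ (Or.inl ⟨j, hj, rfl⟩) ⟨y, hy, p, hp, hyp⟩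
    · exact h σ (Or.inr ⟨k, hk⟩) ⟨y, hy, p, hp, hyp⟩

end OLSC

/-- The lines that bound the region where the segment `ab` occludes the segment `se`. -/
def occFuns (s e a b : Plane) : Set (Plane → ℝ) :=
  {fun x => orient3 e x a, fun x => orient3 e x b, fun x => orient3 x s a,
    fun x => orient3 x s b, fun x => orient3 a b x}

namespace OLSC

variable {n u : ℕ}

/-- The range and angle constraints of target `i`. -/
noncomputable def rangeFuns (I : OLSC n u) (i : Fin n) : Set (Plane → ℝ) :=
  let s := (I.target i).start
  let e := (I.target i).finish
  {fun x => orient3 s e x,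
    fun x => inner ℝ (x - s) (e - s), fun x => inner ℝ (e - x) (e - s),
    fun x => orient3 s e x - I.Rmin * dist s e, fun x => orient3 s e x + I.Rmin * dist s e,
    fun x => dist x s ^ 2 - I.Rmax ^ 2, fun x => dist x e ^ 2 - I.Rmax ^ 2,
    fun x => dist x s ^ 2 - I.Rmin ^ 2, fun x => dist x e ^ 2 - I.Rmin ^ 2,
    aovFun I.θ 1 s e, aovFun I.θ (-1) s e}

/-- Equations of lines and circles that contain the boundary of the camera placement field. -/
noncomputable def targetFuns (I : OLSC n u) (i : Fin n) : Set (Plane → ℝ) :=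
  I.rangeFuns i ∪ ⋃ σ ∈ I.occSegs i,
    (occFuns (I.target i).start (I.target i).finish σ.1 σ.2 ∪
      occFuns (I.target i).finish (I.target i).start σ.1 σ.2)

theorem finite_targetFuns (I : OLSC n u) (i : Fin n) : (I.targetFuns i).Finite := by
  refine Set.Finite.union ?_ ((I.finite_occSegs i).biUnion fun σ _ => ?_)
  · simp [rangeFuns]
  · simp [occFuns]

theorem rangeFuns_subset (I : OLSC n u) (i : Fin n) : I.rangeFuns i ⊆ I.targetFuns i :=
  Set.subset_union_left

theorem isAffine_occFuns {s e a b : Plane} {f : Plane → ℝ} (hf : f ∈ occFuns s e a b) :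
    ∃ b c d : ℝ, ∀ x, f x = b * x 0 + c * x 1 + d := by
  rcases hf with rfl | rfl | rfl | rfl | rfl
  · exact ⟨a 1 - e 1, e 0 - a 0, e 1 * a 0 - e 0 * a 1, fun x => by simp only [orient3]; ring⟩
  · exact ⟨b 1 - e 1, e 0 - b 0, e 1 * b 0 - e 0 * b 1, fun x => by simp only [orient3]; ring⟩
  · exact ⟨s 1 - a 1, a 0 - s 0, s 0 * a 1 - s 1 * a 0, fun x => by simp only [orient3]; ring⟩
  · exact ⟨s 1 - b 1, b 0 - s 0, s 0 * b 1 - s 1 * b 0, fun x => by simp only [orient3]; ring⟩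
  · exact ⟨a 1 - b 1, b 0 - a 0, a 0 * b 1 - a 1 * b 0, fun x => by simp only [orient3]; ring⟩

/-- Each function in the family is affine, or the equation of a circle that leaves the half plane
in front of the target. -/
theorem targetFuns_cases (I : OLSC n u) (i : Fin n) {f : Plane → ℝ} (hf : f ∈ I.targetFuns i) :
    (∃ b c d : ℝ, ∀ x, f x = b * x 0 + c * x 1 + d) ∨
      ∃ l : ℝ, ∃ c : Plane, ∃ r : ℝ, l ≠ 0 ∧ 0 ≤ r ∧
        (∀ x, f x = l * ((x 0 - c 0) ^ 2 + (x 1 - c 1) ^ 2 - r ^ 2)) ∧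
        (r = 0 ∨ (I.target i).front c < r * ‖(I.target i).orient‖) := by
  have hD : 0 < ‖(I.target i).orient‖ := norm_pos_iff.2 (I.target i).orient_ne_zero
  have hs : (I.target i).front (I.target i).start = 0 := by
    rw [OLSTarget.front_eq, sub_self, inner_zero_right]
  have he : (I.target i).front (I.target i).finish = 0 := by
    rw [OLSTarget.front_eq, (I.target i).orient_perp]
  have hcirc : ∀ (c : Plane) (r : ℝ), 0 ≤ r → (I.target i).front c = 0 →
      ∃ l : ℝ, ∃ c' : Plane, ∃ r' : ℝ, l ≠ 0 ∧ 0 ≤ r' ∧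
        (∀ x : Plane, dist x c ^ 2 - r ^ 2 =
          l * ((x 0 - c' 0) ^ 2 + (x 1 - c' 1) ^ 2 - r' ^ 2)) ∧
        (r' = 0 ∨ (I.target i).front c' < r' * ‖(I.target i).orient‖) := by
    intro c r hr hc
    refine ⟨1, c, r, one_ne_zero, hr, fun x => by rw [Plane.dist_sq_eq, one_mul], ?_⟩
    rcases hr.eq_or_lt with h | h
    · exact Or.inl h.symm
    · right
      rw [hc]
      positivity
  have haov : ∀ ε : ℝ, (ε = 1 ∨ ε = -1) →
      ∃ l : ℝ, ∃ c' : Plane, ∃ r' : ℝ, l ≠ 0 ∧ 0 ≤ r' ∧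
        (∀ x : Plane, aovFun I.θ ε (I.target i).start (I.target i).finish x =
          l * ((x 0 - c' 0) ^ 2 + (x 1 - c' 1) ^ 2 - r' ^ 2)) ∧
        (r' = 0 ∨ (I.target i).front c' < r' * ‖(I.target i).orient‖) := by
    intro ε hε
    have hsin := I.sin_θ_pos
    refine ⟨_, _, _, hsin.ne', ?_, aovFun_eq hsin hε _ _, Or.inr ?_⟩
    · positivity
    · set c := aovCenter I.θ ε (I.target i).start (I.target i).finish with hcdef
      set r := dist (I.target i).start (I.target i).finish / (2 * Real.sin I.θ) with hrdef
      have hr : 0 < r := div_pos (dist_pos.2 (I.target i).start_ne_finish) (by positivity)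
      have h1 : (I.target i).front c ≤
          ‖(I.target i).orient‖ * ‖c - midpoint ℝ (I.target i).start (I.target i).finish‖ :=
        real_inner_le_norm _ _
      -- The centre is at distance `r * |cos θ|` from the midpoint of the chord, and `sin θ > 0`.
      have h2 : ‖c - midpoint ℝ (I.target i).start (I.target i).finish‖ < r := by
        rw [← sq_lt_sq₀ (norm_nonneg _) hr.le, Plane.norm_sq_eq, hrdef, div_pow,
          Plane.dist_sq_eq, midpoint_eq_smul_add]
        have hε2 : ε ^ 2 = 1 := by rcases hε with h | h <;> simp [h]
        have hd : 0 < ((I.target i).start 0 - (I.target i).finish 0) ^ 2 +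
            ((I.target i).start 1 - (I.target i).finish 1) ^ 2 := by
          rw [← Plane.dist_sq_eq]
          exact pow_pos (dist_pos.2 (I.target i).start_ne_finish) 2
        have hcs := Real.sin_sq_add_cos_sq I.θ
        simp [hcdef, aovCenter]
        rw [lt_div_iff₀ (by positivity)]
        have key : ∀ p0 p1 q0 q1 : ℝ,
            (((p0 + q0) / 2 + ε * (Real.cos I.θ / Real.sin I.θ) / 2 * (p1 - q1)
              - 2⁻¹ * (p0 + q0)) ^ 2 +
            ((p1 + q1) / 2 - ε * (Real.cos I.θ / Real.sin I.θ) / 2 * (p0 - q0)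
              - 2⁻¹ * (p1 + q1)) ^ 2) * (2 * Real.sin I.θ) ^ 2 =
            Real.cos I.θ ^ 2 * ((p0 - q0) ^ 2 + (p1 - q1) ^ 2) := by
          intro p0 p1 q0 q1
          field_simp
          linear_combination (Real.cos I.θ ^ 2 * ((p0 - q0) ^ 2 + (p1 - q1) ^ 2)) * hε2
        have k := key ((I.target i).start 0) ((I.target i).start 1) ((I.target i).finish 0)
          ((I.target i).finish 1)
        nlinarith [mul_pos (pow_pos hsin 2) hd]
      calc _ ≤ _ := h1
        _ < ‖(I.target i).orient‖ * r := mul_lt_mul_of_pos_left h2 hD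
        _ = _ := mul_comm _ _
  rcases hf with hf | hf
  · rcases hf with rfl | rfl | rfl | rfl | rfl | rfl | rfl | rfl | rfl | rfl | rfl
    · left
      -- The last member of `occFuns` does not involve `s` and `e`, so these are filled in
      -- arbitrarily.
      exact isAffine_occFuns (s := (I.target i).start) (e := (I.target i).start)
        (Or.inr (Or.inr (Or.inr (Or.inr rfl))))
    · left
      set s := (I.target i).start
      set e := (I.target i).finish
      exact ⟨e 0 - s 0, e 1 - s 1, -(s 0 * (e 0 - s 0) + s 1 * (e 1 - s 1)), fun x => by
        simp only [Plane.inner_eq, PiLp.sub_apply]; ring⟩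
    · left
      set s := (I.target i).start
      set e := (I.target i).finish
      exact ⟨-(e 0 - s 0), -(e 1 - s 1), e 0 * (e 0 - s 0) + e 1 * (e 1 - s 1), fun x => by
        simp only [Plane.inner_eq, PiLp.sub_apply]; ring⟩
    · left
      set s := (I.target i).start
      set e := (I.target i).finish
      exact ⟨s 1 - e 1, e 0 - s 0, s 0 * e 1 - s 1 * e 0 - I.Rmin * dist s e, fun x => by
        simp only [orient3]; ring⟩
    · left
      set s := (I.target i).start
      set e := (I.target i).finish
      exact ⟨s 1 - e 1, e 0 - s 0, s 0 * e 1 - s 1 * e 0 + I.Rmin * dist s e, fun x => by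
        simp only [orient3]; ring⟩
    · exact Or.inr (hcirc _ _ (I.Rmin_nonneg.trans I.Rmin_le_Rmax) hs)
    · exact Or.inr (hcirc _ _ (I.Rmin_nonneg.trans I.Rmin_le_Rmax) he)
    · exact Or.inr (hcirc _ _ I.Rmin_nonneg hs)
    · exact Or.inr (hcirc _ _ I.Rmin_nonneg he)
    · exact Or.inr (haov 1 (Or.inl rfl))
    · exact Or.inr (haov (-1) (Or.inr rfl))
  · obtain ⟨σ, -, hf | hf⟩ := Set.mem_iUnion₂.1 hf
    · exact Or.inl (isAffine_occFuns hf)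
    · exact Or.inl (isAffine_occFuns hf)

theorem isQuad_targetFuns (I : OLSC n u) (i : Fin n) : ∀ f ∈ I.targetFuns i, IsQuad f := by
  intro f hf
  rcases I.targetFuns_cases i hf with ⟨b, c, d, h⟩ | ⟨l, c, r, -, -, h, -⟩
  · exact ⟨0, b, c, d, fun x => by rw [h]; ring⟩
  · exact ⟨l, -2 * l * c 0, -2 * l * c 1, l * (c 0 ^ 2 + c 1 ^ 2 - r ^ 2),
      fun x => by rw [h]; ring⟩

/-- A circle whose equation is in the family has a point behind the target. -/
theorem exists_front_neg_of_circle (I : OLSC n u) (i : Fin n) {f g : Plane → ℝ}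
    (hf : f ∈ I.targetFuns i) {p q r : ℝ} (hr : 0 < r)
    (hg : ∀ x, g x = (x 0 - p) ^ 2 + (x 1 - q) ^ 2 - r ^ 2) {m : ℝ} (hm : m ≠ 0)
    (hfg : f = m • g) : ∃ x, g x = 0 ∧ (I.target i).front x < 0 := by
  have hval : ∀ x, f x = m * ((x 0 - p) ^ 2 + (x 1 - q) ^ 2 - r ^ 2) := fun x => by
    rw [hfg, Pi.smul_apply, smul_eq_mul, hg]
  rcases I.targetFuns_cases i hf with ⟨b, c, d, h⟩ | ⟨l, c, ρ, hl, hρ, h, hc⟩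
  · exfalso
    -- An affine function vanishing at two antipodal points of the circle also vanishes at its
    -- centre, where `m • g` equals `-m r²`.
    have h1 := hval !₂[p + r, q]
    have h2 := hval !₂[p - r, q]
    have h3 := hval !₂[p, q]
    rw [h] at h1 h2 h3
    simp at h1 h2 h3
    have : m * r ^ 2 = 0 := by linear_combination -(h1 + h2) / 2 + h3
    exact (mul_ne_zero hm (pow_pos hr 2).ne') this
  · rcases hc with rfl | hc
    · exfalso
      have h1 := hval !₂[p + r, q]
      have h2 := hval !₂[p - r, q]
      rw [h] at h1 h2
      simp [hl] at h1 h2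
      have h3 : r * (p - c 0) = 0 := by linear_combination (h1 - h2) / 4
      have h4 : p - c 0 = 0 := (mul_eq_zero.1 h3).resolve_left hr.ne'
      nlinarith [sq_nonneg (q - c 1), pow_pos hr 2]
    · have hD : 0 < ‖(I.target i).orient‖ := norm_pos_iff.2 (I.target i).orient_ne_zero
      -- The point of the circle farthest against the orientation vector.
      refine ⟨c - (ρ / ‖(I.target i).orient‖) • (I.target i).orient, ?_, ?_⟩
      · have h1 : f (c - (ρ / ‖(I.target i).orient‖) • (I.target i).orient) = 0 := by
          rw [h]
          have h2 := Plane.norm_sq_eq (I.target i).orient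
          simp only [PiLp.sub_apply, PiLp.smul_apply, smul_eq_mul]
          have : (c 0 - ρ / ‖(I.target i).orient‖ * (I.target i).orient 0 - c 0) ^ 2 +
              (c 1 - ρ / ‖(I.target i).orient‖ * (I.target i).orient 1 - c 1) ^ 2 - ρ ^ 2 = 0 := by
            field_simp
            linear_combination -ρ ^ 2 * h2
          rw [this, mul_zero]
        rw [hfg, Pi.smul_apply, smul_eq_mul] at h1
        exact (mul_eq_zero.1 h1).resolve_left hm
      · have : (I.target i).front (c - (ρ / ‖(I.target i).orient‖) • (I.target i).orient) =
            (I.target i).front c - ρ * ‖(I.target i).orient‖ := by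
          rw [OLSTarget.front_eq, OLSTarget.front_eq, sub_right_comm, inner_sub_right,
            real_inner_smul_right, real_inner_self_eq_norm_sq]
          field_simp
        rw [this]
        linarith

/-- Up to a nonzero constant the front function is `orient3 s e x`. The blocking criterion needs
this area to be positive; when it is negative the end points are exchanged, which is why
`targetFuns` contains `occFuns` in both orders. -/
theorem adapted_strictFrontalView (I : OLSC n u) (i : Fin n) :
    Adapted (I.targetFuns i) {x | I.StrictFrontalView i x} := by
  intro x y hs hx
  rw [Set.mem_ofPred_eq, strictFrontalView_iff] at hx ⊢
  obtain ⟨l, hl, hfront⟩ := (I.target i).exists_front_eq_mul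
  set s := (I.target i).start with hsdef
  set e := (I.target i).finish with hedef
  have hor : SignType.sign (orient3 s e x) = SignType.sign (orient3 s e y) :=
    hs (fun x => orient3 s e x) (Or.inl (Or.inl rfl))
  have hocc : ∀ σ ∈ I.occSegs i, ∀ f ∈ occFuns s e σ.1 σ.2 ∪ occFuns e s σ.1 σ.2,
      SignType.sign (f x) = SignType.sign (f y) := fun σ hσ f hf =>
    hs f (Or.inr (Set.mem_biUnion hσ hf))
  have hfy : 0 < (I.target i).front y := by
    have := hx.1
    rw [hfront] at this ⊢
    rwa [← pos_iff_of_sign_eq (a := l * orient3 s e x)]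
    rw [sign_mul, sign_mul, hor]
  refine ⟨hfy, fun σ hσ hyb => hx.2 σ hσ ?_⟩
  have hne : orient3 s e y ≠ 0 := fun h0 => by
    rw [hfront, h0, mul_zero] at hfy
    exact lt_irrefl _ hfy
  rcases lt_or_gt_of_ne hne with hneg | hpos
  · rw [← blocked_swap] at hyb ⊢
    have h := hocc σ hσ
    refine mem_blocked_of_sign_eq ?_ ?_ ?_ ?_ ?_ ?_ ?_ hyb
    · rw [orient3_swap]; linarith
    · rw [orient3_swap]; linarith [(neg_iff_of_sign_eq hor).2 hneg]
    · exact (h _ (Or.inr (Or.inl rfl))).symm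
    · exact (h _ (Or.inr (Or.inr (Or.inl rfl)))).symm
    · exact (h _ (Or.inr (Or.inr (Or.inr (Or.inl rfl))))).symm
    · exact (h _ (Or.inr (Or.inr (Or.inr (Or.inr (Or.inl rfl)))))).symm
    · exact (h _ (Or.inr (Or.inr (Or.inr (Or.inr (Or.inr rfl)))))).symm
  · have h := hocc σ hσ
    refine mem_blocked_of_sign_eq hpos ((pos_iff_of_sign_eq hor).2 hpos) ?_ ?_ ?_ ?_ ?_ hyb
    · exact (h _ (Or.inl (Or.inl rfl))).symm
    · exact (h _ (Or.inl (Or.inr (Or.inl rfl)))).symm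
    · exact (h _ (Or.inl (Or.inr (Or.inr (Or.inl rfl))))).symm
    · exact (h _ (Or.inl (Or.inr (Or.inr (Or.inr (Or.inl rfl)))))).symm
    · exact (h _ (Or.inl (Or.inr (Or.inr (Or.inr (Or.inr rfl)))))).symm

/-- Disc and wedge are convex, so end points suffice for them; being outside the inner disc is not a
convex condition and must be kept for all points. -/
theorem seg_subset_frustum_iff (I : OLSC n u) (i : Fin n) (x : Plane) (α : ℝ) :
    (I.target i).seg ⊆ I.frustum x α ↔
      ((∀ p ∈ (I.target i).seg, I.Rmin ≤ dist x p) ∧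
        dist x (I.target i).start ≤ I.Rmax ∧ dist x (I.target i).finish ≤ I.Rmax) ∧
      InWedge I.θ α ((I.target i).start - x) ∧ InWedge I.θ α ((I.target i).finish - x) := by
  have hs : (I.target i).start ∈ (I.target i).seg := left_mem_segment ℝ _ _
  have he : (I.target i).finish ∈ (I.target i).seg := right_mem_segment ℝ _ _
  constructor
  · intro h
    exact ⟨⟨fun p hp => (h hp).1, (h hs).2.1, (h he).2.1⟩, (h hs).2.2, (h he).2.2⟩
  · rintro ⟨⟨h1, h2, h3⟩, h4, h5⟩ p hp
    refine ⟨h1 p hp, ?_, ?_⟩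
    · have := (convex_closedBall x I.Rmax).segment_subset
        (Metric.mem_closedBall'.2 h2) (Metric.mem_closedBall'.2 h3) hp
      exact Metric.mem_closedBall'.1 this
    · obtain ⟨a, b, ha, hb, hab, rfl⟩ := hp
      have := convex_inWedge (α := α) I.θ_pos I.θ_lt_pi h4 h5 ha hb hab
      have he : a • ((I.target i).start - x) + b • ((I.target i).finish - x) =
          a • (I.target i).start + b • (I.target i).finish - x := by
        obtain rfl : b = 1 - a := by linarith
        module
      rw [he] at this
      exact this

/-- The locations at which target `i` satisfies the range constraints. -/
def inRange (I : OLSC n u) (i : Fin n) : Set Plane :=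
  {x | (∀ p ∈ (I.target i).seg, I.Rmin ≤ dist x p) ∧
    dist x (I.target i).start ≤ I.Rmax ∧ dist x (I.target i).finish ≤ I.Rmax}

theorem covers_iff (I : OLSC n u) (i : Fin n) (x : Plane) (α : ℝ) :
    I.Covers x α i ↔ (x ∈ I.inRange i ∧ x ∈ I.frontalView i) ∧
      InWedge I.θ α ((I.target i).start - x) ∧ InWedge I.θ α ((I.target i).finish - x) := by
  rw [Covers, seg_subset_frustum_iff]
  exact ⟨fun h => ⟨⟨h.1.1, h.2⟩, h.1.2⟩, fun h => ⟨⟨h.1.1, h.2⟩, h.1.2⟩⟩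

theorem mem_cpf_iff (I : OLSC n u) (i : Fin n) (x : Plane) :
    x ∈ I.cpf i ↔ (x ∈ I.inRange i ∧ x ∈ I.frontalView i) ∧
      AngleLE I.θ ((I.target i).start - x) ((I.target i).finish - x) := by
  rw [← exists_inWedge_pair_iff I.θ_pos I.θ_lt_pi]
  simp only [cpf, Set.mem_ofPred_eq, covers_iff, exists_and_left]

theorem adapted_inRange_angle (I : OLSC n u) (i : Fin n) :
    Adapted (I.targetFuns i) (I.inRange i ∩
      {x | AngleLE I.θ ((I.target i).start - x) ((I.target i).finish - x)}) := by
  have hmax : ∀ x p : Plane, dist x p ≤ I.Rmax ↔ dist x p ^ 2 - I.Rmax ^ 2 ≤ 0 := fun x p => by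
    rw [sub_nonpos, sq_le_sq₀ dist_nonneg (I.Rmin_nonneg.trans I.Rmin_le_Rmax)]
  intro x y hs hx
  replace hs : ∀ f ∈ I.rangeFuns i, SignType.sign (f x) = SignType.sign (f y) :=
    fun f hf => hs f (I.rangeFuns_subset i hf)
  simp only [rangeFuns, Set.mem_insert_iff, Set.mem_singleton_iff, forall_eq_or_imp,
    forall_eq] at hs
  obtain ⟨s1, s2, s3, s4, s5, s6, s7, s8, s9, s10, s11⟩ := hs
  have hmin := forall_le_dist_iff (I.target i).start_ne_finish I.Rmin_nonneg
  simp only [inRange, OLSTarget.seg, Set.mem_inter_iff, Set.mem_ofPred_eq, hmin, hmax,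
    angleLE_iff_sign I.θ_pos I.θ_lt_pi] at hx ⊢
  simp only [aovFun, cross_sub_eq_orient3, one_mul, neg_mul, sub_neg_eq_add] at hx s10 s11 ⊢
  rwa [nonneg_iff_of_sign_eq s1, nonpos_iff_of_sign_eq s1, nonneg_iff_of_sign_eq s2,
    nonneg_iff_of_sign_eq s3, nonneg_iff_of_sign_eq s4, nonpos_iff_of_sign_eq s5,
    nonpos_iff_of_sign_eq s6, nonpos_iff_of_sign_eq s7, nonneg_iff_of_sign_eq s8,
    nonneg_iff_of_sign_eq s9, nonneg_iff_of_sign_eq s10, nonneg_iff_of_sign_eq s11] at hx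

theorem cpf_eq (I : OLSC n u) (i : Fin n) : I.cpf i = I.frontalView i ∩ (I.inRange i ∩
    {x | AngleLE I.θ ((I.target i).start - x) ((I.target i).finish - x)}) := by
  ext x
  rw [mem_cpf_iff]
  simp only [Set.mem_inter_iff, Set.mem_ofPred_eq]
  tauto

/-- The frontal view is only the closure of an adapted set, so it is handled through
`LocSign.closure`; the remaining constraints are adapted themselves. -/
theorem locSign_cpf (I : OLSC n u) (i : Fin n) {F : Set (Plane → ℝ)} (hF : F.Finite)
    (hq : ∀ f ∈ F, IsQuad f) (hiF : I.targetFuns i ⊆ F) {z : Plane} {g : Plane → ℝ}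
    (hg : IsRegularAt F z g) : LocSign g (I.cpf i) z := by
  rw [cpf_eq]
  exact ((((I.adapted_strictFrontalView i).mono hiF).locSign hF hq hg).closure hg.isTame).inter
    (((I.adapted_inRange_angle i).mono hiF).locSign hF hq hg)

/-! ### Finiteness of the set of candidates -/

/-- Equations of the AOV circles. -/
def aovFuns (I : OLSC n u) : Set (Plane → ℝ) :=
  {f | ∃ j k, ∃ p ∈ (I.target j).ends, ∃ q ∈ (I.target k).ends, ∃ ε ∈ ({1, -1} : Set ℝ),
    f = aovFun I.θ ε p q}

theorem finite_aovFuns (I : OLSC n u) : I.aovFuns.Finite := by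
  have : I.aovFuns = ⋃ j, ⋃ k, ⋃ p ∈ (I.target j).ends, ⋃ q ∈ (I.target k).ends,
      (fun ε => aovFun I.θ ε p q) '' {1, -1} := by
    ext f
    simp only [aovFuns, Set.mem_ofPred_eq, Set.mem_iUnion, Set.mem_image, exists_prop, eq_comm]
  rw [this]
  have hE : ∀ j, (I.target j).ends.Finite := fun j => (Set.finite_singleton _).insert _
  exact Set.finite_iUnion fun j => Set.finite_iUnion fun k =>
    (hE j).biUnion fun p _ => (hE k).biUnion fun q _ => (Set.toFinite _).image _

theorem exists_aovFun_of_mem_aovCircles (I : OLSC n u) {C : Set Plane} (hC : C ∈ I.aovCircles) :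
    ∃ p q : Plane, p ≠ q ∧ ∃ ε : ℝ, (ε = 1 ∨ ε = -1) ∧ aovFun I.θ ε p q ∈ I.aovFuns ∧
      C = {x | aovFun I.θ ε p q x = 0} := by
  obtain ⟨j, k, -, p, hp, q, hq, hpq, c, r, rfl, rfl, hpC, hqC⟩ := hC
  obtain ⟨ε, hε, h⟩ := sphere_eq_setOf_aovFun I.sin_θ_pos hpq hpC hqC
  exact ⟨p, q, hpq, ε, hε, ⟨j, k, p, hp, q, hq, ε, hε, rfl⟩, h⟩

theorem aovFun_mem_aovCircles (I : OLSC n u) {j k : Fin n} (hjk : j ≠ k) {p q : Plane}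
    (hp : p ∈ (I.target j).ends) (hq : q ∈ (I.target k).ends) (hpq : p ≠ q) {ε : ℝ}
    (hε : ε = 1 ∨ ε = -1) : {x | aovFun I.θ ε p q x = 0} ∈ I.aovCircles :=
  ⟨j, k, hjk, p, hp, q, hq, hpq, _, _, rfl, setOf_aovFun_eq I.sin_θ_pos hε p q,
    aovFun_left _ _ _ _, aovFun_right _ _ _ _⟩

theorem finite_candidates (I : OLSC n u) : I.candidates.Finite := by
  set F : Set (Plane → ℝ) := (⋃ i, I.targetFuns i) ∪ I.aovFuns with hFdef
  have hF : F.Finite := (Set.finite_iUnion I.finite_targetFuns).union I.finite_aovFuns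
  have hq : ∀ f ∈ F, IsQuad f := by
    rintro f (hf | ⟨j, k, p, -, q, -, ε, -, rfl⟩)
    · obtain ⟨i, hi⟩ := Set.mem_iUnion.1 hf
      exact I.isQuad_targetFuns i f hi
    · exact isQuad_aovFun _ _ _ _
  have hi : ∀ i, I.targetFuns i ⊆ F := fun i =>
    (Set.subset_iUnion I.targetFuns i).trans Set.subset_union_left
  obtain ⟨Z, hZ, hreg⟩ := exists_finite_isRegularAt hF hq
  refine hZ.subset fun z hz => ?_
  by_contra hzZ
  obtain ⟨g, hg⟩ := hreg z hzZ
  have hcpf : ∀ i, LocSign g (I.cpf i) z := fun i => I.locSign_cpf i hF hq (hi i) hg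
  rcases hz with (hz | ⟨i, j, -, hz⟩) | ⟨i, C, hC, hz⟩
  · obtain ⟨i, hz⟩ := Set.mem_iUnion.1 hz
    exact hg.notMem_vertices (hcpf i) hz
  · exact hg.notMem_crossings (hcpf i) (hcpf j) hz
  · obtain ⟨p, q, hpq, ε, hε, hf, rfl⟩ := I.exists_aovFun_of_mem_aovCircles hC
    have hr : 0 < dist p q / (2 * Real.sin I.θ) :=
      div_pos (dist_pos.2 hpq) (mul_pos two_pos I.sin_θ_pos)
    -- The AOV circle is treated as the frontier of its closed disc, so that the crossing argument
    -- for two frontiers applies.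
    have hball : Adapted F (Metric.closedBall (aovCenter I.θ ε p q)
        (dist p q / (2 * Real.sin I.θ))) := by
      have hmem : ∀ x, x ∈ Metric.closedBall (aovCenter I.θ ε p q)
          (dist p q / (2 * Real.sin I.θ)) ↔ aovFun I.θ ε p q x ≤ 0 := fun x => by
        rw [Metric.mem_closedBall, ← sq_le_sq₀ dist_nonneg hr.le, Plane.dist_sq_eq,
          aovFun_eq I.sin_θ_pos hε, ← sub_nonpos]
        exact (smul_nonpos_iff_nonpos_of_pos_left I.sin_θ_pos).symm
      intro x y hs hx
      rw [hmem] at hx ⊢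
      exact (nonpos_iff_of_sign_eq (hs _ (Or.inr hf))).1 hx
    rw [setOf_aovFun_eq I.sin_θ_pos hε, ← frontier_closedBall _ hr.ne'] at hz
    exact hg.notMem_crossings (hcpf i) (hball.locSign hF hq hg) hz

end OLSC

/-! ### Tangents, coinciding curves and exit times -/

theorem AngleLE.symm {θ : ℝ} {u v : Plane} (h : AngleLE θ u v) : AngleLE θ v u := by
  unfold AngleLE at *
  rwa [mul_comm ‖v‖, real_inner_comm]

/-- Lines and circles have a tangent at each of their points. -/
theorem IsCurveFun.exists_hasDerivAt {g : Plane → ℝ} (hg : IsCurveFun g) {z : Plane}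
    (hz : g z = 0) : ∃ γ : ℝ → Plane, ∃ τ : Plane, γ 0 = z ∧ τ ≠ 0 ∧ HasDerivAt γ τ 0 ∧
      ∀ t, g (γ t) = 0 := by
  rcases hg with ⟨b, c, d, hbc, h⟩ | ⟨p, q, r, hr, h⟩
  · refine ⟨fun t => z + t • !₂[c, -b], !₂[c, -b], by simp, ?_, ?_, fun t => ?_⟩
    · intro h0
      have h1 := congrArg (fun v : Plane => v 0) h0
      have h2 := congrArg (fun v : Plane => v 1) h0
      simp at h1 h2
      tauto
    · simpa using ((hasDerivAt_id (0 : ℝ)).smul_const (!₂[c, -b] : Plane)).const_add z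
    · rw [h] at hz ⊢
      simp
      linear_combination hz
  · refine ⟨fun t => !₂[p, q] + (Real.cos t • !₂[z 0 - p, z 1 - q] +
      Real.sin t • !₂[-(z 1 - q), z 0 - p]), !₂[-(z 1 - q), z 0 - p], ?_, ?_, ?_, fun t => ?_⟩
    · apply Plane.ext <;> simp
    · intro h0
      have h1 := congrArg (fun v : Plane => v 0) h0
      have h2 := congrArg (fun v : Plane => v 1) h0
      simp only [PiLp.zero_apply, Matrix.cons_val_zero, Matrix.cons_val_one] at h1 h2
      rw [h] at hz
      nlinarith [pow_pos hr 2]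
    · have := (((Real.hasDerivAt_cos 0).smul_const (!₂[z 0 - p, z 1 - q] : Plane)).add
        ((Real.hasDerivAt_sin 0).smul_const (!₂[-(z 1 - q), z 0 - p] : Plane))).const_add
        (!₂[p, q] : Plane)
      simpa using this
    · rw [h] at hz ⊢
      simp
      linear_combination ((z 0 - p) ^ 2 + (z 1 - q) ^ 2) * Real.sin_sq_add_cos_sq t + hz

/-- If two sets look like two lines or circles near a common point that is not an isolated point
of their intersection, then these lines or circles coincide. -/
theorem IsCurveFun.eq_smul_of_notMem_crossings {g g' : Plane → ℝ} (hg : IsCurveFun g)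
    (hg' : IsCurveFun g') {A B V W : Set Plane} {z : Plane} (hz : g z = 0) (hz' : g' z = 0)
    (hV : V ∈ 𝓝 z) (hAV : A ∩ V = {x | g x = 0} ∩ V) (hW : W ∈ 𝓝 z)
    (hBW : B ∩ W = {x | g' x = 0} ∩ W) (hcr : z ∉ crossings A B) :
    ∃ l : ℝ, l ≠ 0 ∧ g' = l • g := by
  refine (hg.inter_finite hg').resolve_left fun hfin => hcr ?_
  have hU : ({x | g x = 0 ∧ g' x = 0} \ {z})ᶜ ∈ 𝓝 z :=
    (hfin.subset Set.sdiff_subset).isClosed.isOpen_compl.mem_nhds (by simp)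
  refine ⟨V ∩ W ∩ ({x | g x = 0 ∧ g' x = 0} \ {z})ᶜ,
    Filter.inter_mem (Filter.inter_mem hV hW) hU, ?_⟩
  ext x
  constructor
  · rintro ⟨⟨hxA, hxB⟩, ⟨hxV, hxW⟩, hxU⟩
    have h1 : x ∈ {x | g x = 0} ∩ V := hAV ▸ ⟨hxA, hxV⟩
    have h2 : x ∈ {x | g' x = 0} ∩ W := hBW ▸ ⟨hxB, hxW⟩
    by_contra hne
    exact hxU ⟨⟨h1.1, h2.1⟩, hne⟩
  · rintro rfl
    have h1 : x ∈ A ∩ V := hAV ▸ ⟨hz, mem_of_mem_nhds hV⟩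
    have h2 : x ∈ B ∩ W := hBW ▸ ⟨hz', mem_of_mem_nhds hW⟩
    exact ⟨⟨h1.1, h2.1⟩, ⟨h1.2, h2.2⟩, by simp⟩

/-- A curve that starts in a closed set and leaves it does so at some time for the first time. -/
theorem exists_exit_time {X : Type*} [TopologicalSpace X] {γ : ℝ → X} (hγ : Continuous γ)
    {K : Set X} (hK : IsClosed K) (h0 : γ 0 ∈ K) (hleave : ∃ t, 0 ≤ t ∧ γ t ∉ K) :
    ∃ T, 0 ≤ T ∧ (∀ t ∈ Set.Icc 0 T, γ t ∈ K) ∧ ∃ᶠ t in 𝓝 T, 0 ≤ t ∧ γ t ∉ K := by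
  set B := {t | 0 ≤ t ∧ γ t ∉ K} with hB
  have hbdd : BddBelow B := ⟨0, fun t ht => ht.1⟩
  have hne : B.Nonempty := hleave
  have hT : 0 ≤ sInf B := le_csInf hne fun t ht => ht.1
  have hlt : ∀ t, 0 ≤ t → t < sInf B → γ t ∈ K := fun t ht htl => by
    by_contra h
    exact absurd (csInf_le hbdd ⟨ht, h⟩) (not_le.2 htl)
  refine ⟨sInf B, hT, fun t ht => ?_, mem_closure_iff_frequently.1 (csInf_mem_closure hne hbdd)⟩
  rcases ht.2.lt_or_eq with h | h
  · exact hlt t ht.1 h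
  · rcases ht.1.eq_or_lt with h' | h'
    · rwa [← h']
    · refine hK.mem_of_tendsto (hγ.continuousAt.tendsto.mono_left
        (nhdsWithin_le_nhds (s := Set.Iio t))) ?_
      filter_upwards [Ioo_mem_nhdsLT h'] with r hr
      exact hlt r hr.1.le (hr.2.trans_eq h)

theorem joinedIn_of_continuous {X : Type*} [TopologicalSpace X] {γ : ℝ → X} (hγ : Continuous γ)
    {K : Set X} {T : ℝ} (hT : 0 ≤ T) (h : ∀ t ∈ Set.Icc 0 T, γ t ∈ K) :
    JoinedIn K (γ 0) (γ T) := by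
  have h1 : IsPathConnected (γ '' Set.Icc 0 T) :=
    ((convex_Icc (0 : ℝ) T).isPathConnected ⟨0, le_refl _, hT⟩).image hγ
  refine (h1.joinedIn _ ⟨0, ⟨le_refl _, hT⟩, rfl⟩ _ ⟨T, ⟨hT, le_refl _⟩, rfl⟩).mono ?_
  rintro _ ⟨t, ht, rfl⟩
  exact h t ht

namespace OLSC

variable {n u : ℕ}

/-! ### Topological properties of the regions -/

theorem isClosed_inRange (I : OLSC n u) (i : Fin n) : IsClosed (I.inRange i) := by
  have h1 : IsClosed {x : Plane | ∀ p ∈ (I.target i).seg, I.Rmin ≤ dist x p} := by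
    simp only [Set.ofPred_forall]
    exact isClosed_biInter fun p _ => isClosed_le continuous_const (by fun_prop)
  have h2 : ∀ p : Plane, IsClosed {x : Plane | dist x p ≤ I.Rmax} := fun p =>
    isClosed_le (by fun_prop) continuous_const
  exact h1.inter ((h2 _).inter (h2 _))

theorem isClosed_cpf (I : OLSC n u) (i : Fin n) : IsClosed (I.cpf i) := by
  rw [cpf_eq]
  refine isClosed_closure.inter ((I.isClosed_inRange i).inter ?_)
  exact isClosed_le (by fun_prop) (by fun_prop)

theorem norm_le_of_mem_cpf (I : OLSC n u) (i : Fin n) {x : Plane} (hx : x ∈ I.cpf i) :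
    ‖x‖ ≤ ‖(I.target i).start‖ + I.Rmax := by
  have h := ((I.mem_cpf_iff i x).1 hx).1.1.2.1
  rw [dist_eq_norm] at h
  have := norm_sub_norm_le x (I.target i).start
  linarith

theorem front_nonneg_of_mem_cpf (I : OLSC n u) (i : Fin n) {x : Plane} (hx : x ∈ I.cpf i) :
    0 ≤ (I.target i).front x := by
  have h := ((I.mem_cpf_iff i x).1 hx).1.2
  refine closure_minimal (fun y hy => ?_) (isClosed_le continuous_const
    (I.target i).continuous_front) h
  exact ((I.strictFrontalView_iff i y).1 hy).1.le

/-- The end points of the targets in `S`. -/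
def endsOf (I : OLSC n u) (S : Finset (Fin n)) : Set Plane :=
  {p | ∃ i ∈ S, p ∈ (I.target i).ends}

theorem finite_endsOf (I : OLSC n u) (S : Finset (Fin n)) : (I.endsOf S).Finite := by
  have : I.endsOf S = ⋃ i ∈ S, (I.target i).ends := by
    ext p
    simp [endsOf]
  rw [this]
  exact S.finite_toSet.biUnion fun i _ => (Set.finite_singleton _).insert _

theorem mem_region_iff (I : OLSC n u) (S : Finset (Fin n)) (x : Plane) :
    x ∈ I.region S ↔ (∀ i ∈ S, x ∈ I.inRange i ∧ x ∈ I.frontalView i) ∧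
      ∃ α, ∀ p ∈ I.endsOf S, InWedge I.θ α (p - x) := by
  constructor
  · rintro ⟨α, h⟩
    refine ⟨fun i hi => ((I.covers_iff i x α).1 (h i hi)).1, α, ?_⟩
    rintro p ⟨i, hi, rfl | rfl⟩
    · exact ((I.covers_iff i x α).1 (h i hi)).2.1
    · exact ((I.covers_iff i x α).1 (h i hi)).2.2
  · rintro ⟨h, α, hα⟩
    exact ⟨α, fun i hi => (I.covers_iff i x α).2
      ⟨h i hi, hα _ ⟨i, hi, Or.inl rfl⟩, hα _ ⟨i, hi, Or.inr rfl⟩⟩⟩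

theorem mem_cpf_of_mem_region (I : OLSC n u) {S : Finset (Fin n)} {x : Plane}
    (hx : x ∈ I.region S) {i : Fin n} (hi : i ∈ S) : x ∈ I.cpf i := by
  obtain ⟨α, h⟩ := hx
  exact ⟨α, h i hi⟩

/-- By periodicity the viewing direction can be taken from a compact interval, and projecting along
a compact factor is a closed map. -/
theorem isClosed_region (I : OLSC n u) (S : Finset (Fin n)) : IsClosed (I.region S) := by
  have hper : Function.Periodic viewDir (2 * Real.pi) := fun t => by simp [viewDir]
  have hcont : Continuous viewDir :=
    Plane.continuous_mk Real.continuous_cos Real.continuous_sin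
  have hreg : I.region S = {x | ∀ i ∈ S, x ∈ I.inRange i ∧ x ∈ I.frontalView i} ∩
      Prod.fst '' {y : Plane × Set.Icc 0 (2 * Real.pi) |
        ∀ p ∈ I.endsOf S, InWedge I.θ y.2 (p - y.1)} := by
    ext x
    rw [mem_region_iff]
    refine and_congr_right fun _ => ⟨?_, ?_⟩
    · rintro ⟨α, hα⟩
      obtain ⟨β, hβ, hαβ⟩ := hper.exists_mem_Ico₀ Real.two_pi_pos α
      refine ⟨(x, ⟨β, hβ.1, hβ.2.le⟩), fun p hp => ?_, rfl⟩
      have := hα p hp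
      rwa [InWedge, hαβ] at this
    · rintro ⟨⟨x', α⟩, h, rfl⟩
      exact ⟨α, h⟩
  rw [hreg]
  refine IsClosed.inter ?_ (isClosedMap_fst_of_compactSpace _ ?_)
  · simp only [Set.ofPred_forall]
    exact isClosed_biInter fun i _ => (I.isClosed_inRange i).inter isClosed_closure
  · simp only [Set.ofPred_forall]
    refine isClosed_biInter fun p _ => isClosed_le (by fun_prop) ?_
    exact (hcont.comp (continuous_subtype_val.comp continuous_snd)).inner (by fun_prop)

/-! ### End points of a target are vertices of its camera placement field -/

theorem notMem_interior_cpf_of_front_eq_zero (I : OLSC n u) (i : Fin n) {p : Plane}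
    (hp : (I.target i).front p = 0) : p ∉ interior (I.cpf i) := by
  intro hint
  have hc : Continuous fun t : ℝ => p - t • (I.target i).orient := by fun_prop
  have h1 : ∀ᶠ t in 𝓝[>] (0 : ℝ), p - t • (I.target i).orient ∈ I.cpf i := by
    apply nhdsWithin_le_nhds
    refine hc.continuousAt.preimage_mem_nhds ?_
    rw [zero_smul, sub_zero]
    exact mem_interior_iff_mem_nhds.1 hint
  obtain ⟨t, ht, ht0 : 0 < t⟩ := (h1.and self_mem_nhdsWithin).exists
  have h2 := I.front_nonneg_of_mem_cpf i ht
  have h3 : (I.target i).front (p - t • (I.target i).orient) =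
      (I.target i).front p - t * ‖(I.target i).orient‖ ^ 2 := by
    rw [OLSTarget.front_eq, OLSTarget.front_eq, sub_right_comm, inner_sub_right,
      real_inner_smul_right, real_inner_self_eq_norm_sq]
  have h4 : 0 < ‖(I.target i).orient‖ := norm_pos_iff.2 (I.target i).orient_ne_zero
  rw [h3, hp] at h2
  nlinarith [mul_pos ht0 (pow_pos h4 2)]

/-- Suppose a single arc of the boundary passed through the end point `p`. The arc stays in front of
the target, so at `p` it is tangent to the target. Moving along it towards the other end point `q`,
one sees `p` and `q` in nearly opposite directions, under an angle tending to `π > θ`. -/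
theorem mem_vertices_of_mem_ends (I : OLSC n u) (i : Fin n) {p : Plane}
    (hp : p ∈ (I.target i).ends) (hpc : p ∈ I.cpf i) : p ∈ vertices (I.cpf i) := by
  obtain ⟨q, hpq, hperp, hfp, hang⟩ : ∃ q : Plane, p ≠ q ∧
      inner ℝ (I.target i).orient (q - p) = 0 ∧ (I.target i).front p = 0 ∧
      ∀ x ∈ I.cpf i, AngleLE I.θ (p - x) (q - x) := by
    have h0 := (I.target i).orient_perp
    rcases hp with rfl | rfl
    · refine ⟨(I.target i).finish, (I.target i).start_ne_finish, h0, ?_,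
        fun x hx => ((I.mem_cpf_iff i x).1 hx).2⟩
      rw [OLSTarget.front_eq, sub_self, inner_zero_right]
    · refine ⟨(I.target i).start, (I.target i).start_ne_finish.symm, ?_, ?_,
        fun x hx => ((I.mem_cpf_iff i x).1 hx).2.symm⟩
      · rw [← neg_sub, inner_neg_right, h0, neg_zero]
      · rw [OLSTarget.front_eq, h0]
  refine ⟨?_, ?_⟩
  · rw [(I.isClosed_cpf i).frontier_eq]
    exact ⟨hpc, I.notMem_interior_cpf_of_front_eq_zero i hfp⟩
  · rintro ⟨Γ, hΓ, V, hV, hfr⟩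
    obtain ⟨g, hg, rfl⟩ := (isLineOrCircle_iff Γ).1 hΓ
    have hgp : g p = 0 := by
      have : p ∈ frontier (I.cpf i) ∩ V := by
        rw [(I.isClosed_cpf i).frontier_eq]
        exact ⟨⟨hpc, I.notMem_interior_cpf_of_front_eq_zero i hfp⟩, mem_of_mem_nhds hV⟩
      rw [hfr] at this
      exact this.1
    have hsub : ∀ x ∈ V, g x = 0 → x ∈ I.cpf i := fun x hxV hx => by
      have : x ∈ frontier (I.cpf i) ∩ V := by rw [hfr]; exact ⟨hx, hxV⟩
      exact (I.isClosed_cpf i).frontier_subset this.1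
    obtain ⟨γ₀, τ₀, h0, hτ₀, hd₀, hγ₀⟩ := hg.exists_hasDerivAt hgp
    -- The curve is reversed if necessary, so that it does not start away from `q`.
    obtain ⟨γ, τ, h0, hτ, hd, hγ, hin⟩ : ∃ γ : ℝ → Plane, ∃ τ : Plane, γ 0 = p ∧ τ ≠ 0 ∧
        HasDerivAt γ τ 0 ∧ (∀ t, g (γ t) = 0) ∧ 0 ≤ inner ℝ τ (q - p) := by
      rcases le_total 0 (inner ℝ τ₀ (q - p)) with h | h
      · exact ⟨γ₀, τ₀, h0, hτ₀, hd₀, hγ₀, h⟩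
      · refine ⟨fun t => γ₀ (-t), -τ₀, by simpa using h0, neg_ne_zero.2 hτ₀, ?_,
          fun t => hγ₀ _, by rw [inner_neg_left]; linarith⟩
        have := HasDerivAt.scomp (0 : ℝ) (g₁ := γ₀) (h := fun t : ℝ => -t) (h' := -1)
          (by simpa using hd₀) (hasDerivAt_neg 0)
        simpa [Function.comp_def] using this
    have hev : ∀ᶠ t in 𝓝 (0 : ℝ), γ t ∈ I.cpf i := by
      have : ∀ᶠ t in 𝓝 (0 : ℝ), γ t ∈ V :=
        hd.continuousAt.preimage_mem_nhds (by rwa [h0])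
      filter_upwards [this] with t ht using hsub _ ht (hγ t)
    -- Along the arc the front function is nonnegative and vanishes at `p`: a local minimum.
    have hDτ : inner ℝ (I.target i).orient τ = 0 := by
      have hder : HasDerivAt (fun t => (I.target i).front (γ t))
          (inner ℝ (I.target i).orient τ) 0 := by
        have := (hasDerivAt_const (0 : ℝ) (I.target i).orient).inner ℝ
          (hd.sub_const (midpoint ℝ (I.target i).start (I.target i).finish))
        simpa [OLSTarget.front] using this
      refine IsLocalMin.hasDerivAt_eq_zero ?_ hder
      filter_upwards [hev] with t ht
      rw [h0, hfp]
      exact I.front_nonneg_of_mem_cpf i ht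
    have hcross : cross τ (q - p) = 0 := by
      have hD := (I.target i).orient_ne_zero
      rw [Plane.inner_eq] at hDτ hperp
      unfold cross
      by_cases hD0 : (I.target i).orient 0 = 0
      · have hD1 : (I.target i).orient 1 ≠ 0 := fun h => hD (Plane.ext hD0 h)
        apply mul_left_cancel₀ hD1
        linear_combination τ 0 * hperp - (q - p) 0 * hDτ
      · apply mul_left_cancel₀ hD0
        linear_combination (q - p) 1 * hDτ - τ 1 * hperp
    have hinner : inner ℝ τ (q - p) = ‖τ‖ * ‖q - p‖ := by
      have := inner_sq_add_cross_sq τ (q - p)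
      rw [hcross, zero_pow two_ne_zero, add_zero] at this
      exact (sq_eq_sq₀ hin (by positivity)).1 this
    have hslope : Filter.Tendsto (fun t : ℝ => t⁻¹ • (γ t - p)) (𝓝[>] 0) (𝓝 τ) := by
      have := hasDerivAt_iff_tendsto_slope_zero.1 hd
      simp only [zero_add, h0] at this
      exact this.mono_left (nhdsWithin_mono _ fun t ht => ne_of_gt ht)
    have hγt : Filter.Tendsto γ (𝓝[>] 0) (𝓝 p) := by
      have := hd.continuousAt.tendsto
      rw [h0] at this
      exact this.mono_left nhdsWithin_le_nhds
    -- The angle condition at `γ t`, divided by `t`, in the limit `t → 0+`.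
    have hlim : Real.cos I.θ * (‖τ‖ * ‖q - p‖) ≤ -inner ℝ τ (q - p) := by
      refine le_of_tendsto_of_tendsto
        (tendsto_const_nhds.mul (hslope.norm.mul (hγt.const_sub q).norm))
        (hslope.inner (hγt.const_sub q)).neg ?_
      filter_upwards [nhdsWithin_le_nhds hev, self_mem_nhdsWithin] with t ht (ht0 : 0 < t)
      have := hang _ ht
      unfold AngleLE at this
      rw [← neg_sub (γ t) p, norm_neg, inner_neg_left] at this
      rw [norm_smul, real_inner_smul_left, norm_inv, Real.norm_of_nonneg ht0.le]
      have h2 := mul_le_mul_of_nonneg_left this (inv_nonneg.2 ht0.le)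
      linarith
    rw [hinner] at hlim
    have hpos : 0 < ‖τ‖ * ‖q - p‖ :=
      mul_pos (norm_pos_iff.2 hτ) (norm_pos_iff.2 (sub_ne_zero.2 hpq.symm))
    have hcos : -1 < Real.cos I.θ := by
      rw [← Real.cos_pi]
      exact Real.cos_lt_cos_of_nonneg_of_le_pi I.θ_pos.le le_rfl I.θ_lt_pi
    nlinarith

/-! ### Moving inside the region of a set of targets -/

theorem exists_curve_of_notMem_candidates (I : OLSC n u) {i : Fin n} {z : Plane}
    (hz : z ∈ frontier (I.cpf i)) (hcand : z ∉ I.candidates) :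
    ∃ g, IsCurveFun g ∧ g z = 0 ∧ ∃ V ∈ 𝓝 z, frontier (I.cpf i) ∩ V = {x | g x = 0} ∩ V := by
  by_contra hno
  refine hcand (Or.inl (Or.inl (Set.mem_iUnion.2 ⟨i, hz, ?_⟩)))
  rintro ⟨Γ, hΓ, V, hV, h⟩
  obtain ⟨g, hg, rfl⟩ := (isLineOrCircle_iff Γ).1 hΓ
  refine hno ⟨g, hg, ?_, V, hV, h⟩
  have : z ∈ frontier (I.cpf i) ∩ V := ⟨hz, mem_of_mem_nhds hV⟩
  rw [h] at this
  exact this.1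

theorem notMem_endsOf_of_notMem_candidates (I : OLSC n u) {S : Finset (Fin n)} {z : Plane}
    (hz : z ∈ I.region S) (hcand : z ∉ I.candidates) : z ∉ I.endsOf S := by
  rintro ⟨j, hj, hzj⟩
  exact hcand (Or.inl (Or.inl (Set.mem_iUnion.2
    ⟨j, I.mem_vertices_of_mem_ends j hzj (I.mem_cpf_of_mem_region hz hj)⟩)))

/-- Away from the candidates, one can move along the boundary of a camera placement field without
leaving the region. -/
theorem eventually_mem_region (I : OLSC n u) {S : Finset (Fin n)} {i : Fin n}
    {z : Plane} (hz : z ∈ I.region S) (hcand : z ∉ I.candidates)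
    {g : Plane → ℝ} (hg : IsCurveFun g) (hgz : g z = 0) {V : Set Plane} (hV : V ∈ 𝓝 z)
    (hfr : frontier (I.cpf i) ∩ V = {x | g x = 0} ∩ V) :
    ∀ᶠ w in 𝓝 z, g w = 0 → w ∈ I.region S := by
  have hcpf : ∀ᶠ w in 𝓝 z, ∀ j ∈ S, g w = 0 → w ∈ I.cpf j := by
    refine (Finset.eventually_all S).2 fun j hj => ?_
    have hzj := I.mem_cpf_of_mem_region hz hj
    by_cases hij : i = j
    · subst hij
      filter_upwards [hV] with w hw hgw
      have : w ∈ frontier (I.cpf i) ∩ V := by rw [hfr]; exact ⟨hgw, hw⟩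
      exact (I.isClosed_cpf i).frontier_subset this.1
    by_cases hint : z ∈ interior (I.cpf j)
    · filter_upwards [mem_interior_iff_mem_nhds.1 hint] with w hw _ using hw
    have hzf : z ∈ frontier (I.cpf j) := by
      rw [(I.isClosed_cpf j).frontier_eq]
      exact ⟨hzj, hint⟩
    obtain ⟨g', hg', hgz', W, hW, hfr'⟩ := I.exists_curve_of_notMem_candidates hzf hcand
    -- Since `z` is not a crossing, the frontier of the other CPF runs along the same curve, and
    -- closedness keeps that curve inside it.
    obtain ⟨l, hl, hgg⟩ := hg.eq_smul_of_notMem_crossings hg' hgz hgz' hV hfr hW hfr'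
      fun hcr => hcand (Or.inl (Or.inr ⟨i, j, hij, hcr⟩))
    filter_upwards [hW] with w hw hgw
    have : w ∈ frontier (I.cpf j) ∩ W := by
      rw [hfr']
      exact ⟨by simp [hgg, hgw], hw⟩
    exact (I.isClosed_cpf j).frontier_subset this.1
  have hends := I.notMem_endsOf_of_notMem_candidates hz hcand
  obtain ⟨-, α, hα⟩ := (I.mem_region_iff S z).1 hz
  have hang : ∀ᶠ w in 𝓝 z, ∀ p ∈ I.endsOf S, ∀ q ∈ I.endsOf S,
      g w = 0 → AngleLE I.θ (p - w) (q - w) := by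
    refine (Filter.eventually_all_finite (I.finite_endsOf S)).2 fun p hp =>
      (Filter.eventually_all_finite (I.finite_endsOf S)).2 fun q hq => ?_
    have hpz : p ≠ z := fun h => hends (h ▸ hp)
    have hqz : q ≠ z := fun h => hends (h ▸ hq)
    have hself : ∀ (p : Plane) (w : Plane), AngleLE I.θ (p - w) (p - w) := fun p w => by
      rw [AngleLE, real_inner_self_eq_norm_sq]
      nlinarith [Real.cos_le_one I.θ, sq_nonneg ‖p - w‖]
    by_cases hpq : p = q
    · subst hpq
      exact Filter.Eventually.of_forall fun w _ => hself p w
    obtain ⟨j, hj, hpj⟩ := id hp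
    obtain ⟨k, hk, hqk⟩ := id hq
    by_cases hjk : j = k
    · subst hjk
      filter_upwards [hcpf] with w hw hgw
      have h := ((I.mem_cpf_iff j w).1 (hw j hj hgw)).2
      rcases hpj with rfl | rfl <;> rcases hqk with rfl | rfl
      · exact hself _ _
      · exact h
      · exact h.symm
      · exact hself _ _
    rcases ((hα p hp).angleLE I.θ_pos I.θ_lt_pi (hα q hq)).eventually I.θ_pos I.θ_lt_pi hpz hqz
      with h | ⟨ε, hε, hεz, h⟩
    · filter_upwards [h] with w hw _ using hw
    · obtain ⟨g', hg', hgg'⟩ := isCurveFun_aovFun I.sin_θ_pos hε hpq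
      have hset : {x | aovFun I.θ ε p q x = 0} = {x | g' x = 0} :=
        setOf_zero_eq_of_smul I.sin_θ_pos.ne' hgg'
      have hgz' : g' z = 0 := (Set.ext_iff.1 hset z).1 hεz
      -- The angle is exactly `θ` at `z`, so `z` lies on an AOV circle. Not being a crossing, it
      -- forces this circle to be the curve `g = 0`, along which the angle condition persists.
      obtain ⟨l, hl, hgg⟩ := hg.eq_smul_of_notMem_crossings hg' hgz hgz' hV hfr
        Filter.univ_mem (B := {x | aovFun I.θ ε p q x = 0}) (by rw [hset])
        fun hcr => hcand (Or.inr ⟨i, _, I.aovFun_mem_aovCircles hjk hpj hqk hpq hε, hcr⟩)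
      filter_upwards [h] with w hw hgw
      exact hw (by simp [hgg', hgg, hgw])
  filter_upwards [hcpf, hang, eventually_exists_inWedge I.θ_pos I.θ_lt_pi (I.finite_endsOf S)
    hends hα] with w h1 h2 h3 hgw
  rw [mem_region_iff]
  exact ⟨fun j hj => ((I.mem_cpf_iff j w).1 (h1 j hj hgw)).1,
    h3 fun p hp q hq => h2 p hp q hq hgw⟩

/-- No full circle is contained in the boundary of a camera placement field. -/
theorem not_circle_subset_frontier_cpf (I : OLSC n u) (i : Fin n) {g : Plane → ℝ} {p q r : ℝ}
    (hr : 0 < r) (hg : ∀ x, g x = (x 0 - p) ^ 2 + (x 1 - q) ^ 2 - r ^ 2) :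
    ¬ ∀ x, g x = 0 → x ∈ frontier (I.cpf i) := by
  intro hall
  have hgc : IsCurveFun g := Or.inr ⟨p, q, r, hr, hg⟩
  obtain ⟨Z, hZ, hreg⟩ := exists_finite_isRegularAt (I.finite_targetFuns i)
    (I.isQuad_targetFuns i)
  have hinf : {x | g x = 0}.Infinite := by
    have h0 : g !₂[p + r, q] = 0 := by rw [hg]; simp
    exact (hgc.infinite_inter_nhds h0 Filter.univ_mem).mono Set.inter_subset_left
  -- At a regular point of the circle the frontier is the zero set of a multiple of a family member.
  -- It contains an arc of the circle, so the circle itself has its equation in the family.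
  obtain ⟨z, hz, hzZ⟩ := hinf.exists_notMem_finite hZ
  obtain ⟨g', hg'⟩ := hreg z hzZ
  obtain ⟨hgz', V, hV, hfr⟩ := (I.locSign_cpf i (I.finite_targetFuns i) (I.isQuad_targetFuns i)
    subset_rfl hg').frontier_eq hg'.isTame (hall z hz)
  obtain ⟨hgc', f, hf, l, hl, hfg⟩ := hg'.isCurveFun hgz'
  rcases hgc.inter_finite hgc' with hfin | ⟨m, hm, hgg⟩
  · refine hgc.infinite_inter_nhds hz hV (hfin.subset ?_)
    rintro x ⟨hx, hxV⟩
    have : x ∈ frontier (I.cpf i) ∩ V := ⟨hall x hx, hxV⟩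
    rw [hfr] at this
    exact ⟨hx, this.1⟩
  · obtain ⟨x, hx, hneg⟩ := I.exists_front_neg_of_circle i hf hr hg (mul_ne_zero hl hm)
      (by rw [hfg, hgg, smul_smul])
    exact absurd (I.front_nonneg_of_mem_cpf i ((I.isClosed_cpf i).frontier_subset (hall x hx)))
      (not_le.2 hneg)

theorem exists_candidate_of_mem_frontier (I : OLSC n u) {S : Finset (Fin n)} {i : Fin n}
    {y : Plane} (hy : y ∈ I.region S) (hyf : y ∈ frontier (I.cpf i)) :
    ∃ p ∈ I.candidates, p ∈ I.region S ∧ JoinedIn (I.region S) y p := by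
  by_contra! hno
  have hyc : y ∉ I.candidates := fun h => hno y h hy (JoinedIn.refl hy)
  obtain ⟨g, hg, hgy, V, hV, hfr⟩ := I.exists_curve_of_notMem_candidates hyf hyc
  obtain ⟨γ, hγ, h0, hgγ, hinj, hfull⟩ := hg.exists_param hgy
  set K := I.region S ∩ frontier (I.cpf i) with hKdef
  have hK : IsClosed K := (I.isClosed_region S).inter isClosed_frontier
  have hstay : ∀ t, 0 ≤ t → γ t ∈ K := by
    by_contra! hleave
    obtain ⟨T, hT, hin, hout⟩ := exists_exit_time hγ hK (h0.symm ▸ ⟨hy, hyf⟩) hleave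
    have hTK := hin T ⟨hT, le_rfl⟩
    have hTc : γ T ∉ I.candidates := fun h => hno _ h hTK.1
      (h0 ▸ joinedIn_of_continuous hγ hT fun t ht => (hin t ht).1)
    obtain ⟨g', hg', hgT', W, hW, hfr'⟩ := I.exists_curve_of_notMem_candidates hTK.2 hTc
    -- For `T > 0` the earlier part of the path accumulates at `T`; for `T = 0` there is none, and
    -- the local description at `y` is used.
    have hfreq : ∃ᶠ t in 𝓝[≠] T, γ t ∈ frontier (I.cpf i) := by
      rcases hT.eq_or_lt with h | h
      · subst h
        refine Filter.Eventually.frequently ?_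
        have : ∀ᶠ t in 𝓝[≠] (0 : ℝ), γ t ∈ V :=
          nhdsWithin_le_nhds (hγ.continuousAt.preimage_mem_nhds (by rwa [h0]))
        filter_upwards [this] with t ht
        have : γ t ∈ frontier (I.cpf i) ∩ V := by rw [hfr]; exact ⟨hgγ t, ht⟩
        exact this.1
      · have : ∀ᶠ t in 𝓝[<] T, γ t ∈ frontier (I.cpf i) := by
          filter_upwards [Ioo_mem_nhdsLT h] with t ht
          exact (hin t ⟨ht.1.le, ht.2.le⟩).2
        exact this.frequently.filter_mono (nhdsWithin_mono _ fun t ht => ne_of_lt ht)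
    have hgg : ∃ l : ℝ, l ≠ 0 ∧ g' = l • g := by
      -- Points of the path different from `γ T` and arbitrarily close to it lie on both curves, so
      -- the curve followed so far and the local frontier at `γ T` coincide.
      refine (hg.inter_finite hg').resolve_left fun hfin => ?_
      have hU : ({x | g x = 0 ∧ g' x = 0} \ {γ T})ᶜ ∈ 𝓝 (γ T) :=
        (hfin.subset Set.sdiff_subset).isClosed.isOpen_compl.mem_nhds (by simp)
      have hev : ∀ᶠ t in 𝓝[≠] T, γ t ∈ W ∩ ({x | g x = 0 ∧ g' x = 0} \ {γ T})ᶜ :=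
        nhdsWithin_le_nhds (hγ.continuousAt.preimage_mem_nhds (Filter.inter_mem hW hU))
      obtain ⟨t, ht, ⟨htW, htU⟩, htne⟩ := (hfreq.and_eventually (hev.and (hinj T))).exists
      have : γ t ∈ frontier (I.cpf i) ∩ W := ⟨ht, htW⟩
      rw [hfr'] at this
      exact htU ⟨⟨hgγ t, this.1⟩, htne⟩
    obtain ⟨l, hl, hgg⟩ := hgg
    have hfrT : frontier (I.cpf i) ∩ W = {x | g x = 0} ∩ W := by
      rw [hfr', setOf_zero_eq_of_smul hl hgg]
    have h1 := I.eventually_mem_region hTK.1 hTc hg (hgγ T) hW hfrT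
    have h2 : ∀ᶠ t in 𝓝 T, γ t ∈ K := by
      filter_upwards [hγ.continuousAt.eventually h1,
        hγ.continuousAt.preimage_mem_nhds hW] with t ht htW
      have : γ t ∈ frontier (I.cpf i) ∩ W := by rw [hfrT]; exact ⟨hgγ t, htW⟩
      exact ⟨ht (hgγ t), this.1⟩
    obtain ⟨t, ⟨-, ht⟩, ht'⟩ := (hout.and_eventually h2).exists
    exact ht ht'
  -- The path now stays on the frontier forever: a line leaves the bounded CPF, and a circle is
  -- swept completely.
  rcases hfull with hunb | ⟨⟨p, q, r, hr, hform⟩, hsurj⟩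
  · obtain ⟨t, ht, hnorm⟩ := hunb (‖(I.target i).start‖ + I.Rmax)
    have := I.norm_le_of_mem_cpf i ((I.isClosed_cpf i).frontier_subset (hstay t ht).2)
    linarith
  · refine I.not_circle_subset_frontier_cpf i hr hform fun x hx => ?_
    obtain ⟨t, ht, rfl⟩ := hsurj x hx
    exact (hstay t ht).2

/-- Moving the camera backwards, one reaches the boundary of a camera placement field. -/
theorem exists_joinedIn_frontier (I : OLSC n u) {S : Finset (Fin n)} (hS : S.Nonempty)
    {x : Plane} (hx : x ∈ I.region S) :
    ∃ y ∈ I.region S, (∃ i, y ∈ frontier (I.cpf i)) ∧ JoinedIn (I.region S) x y := by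
  obtain ⟨-, α, hα⟩ := (I.mem_region_iff S x).1 hx
  set β : ℝ → Plane := fun t => x - t • viewDir α with hβdef
  have hβ : Continuous β := by fun_prop
  have hβ0 : β 0 = x := by simp [hβdef]
  set K : Set Plane := {z | ∀ i ∈ S, z ∈ I.cpf i} with hKdef
  have hK : IsClosed K := by
    simp only [hKdef, Set.ofPred_forall]
    exact isClosed_biInter fun i _ => I.isClosed_cpf i
  -- With `α` kept fixed the common wedge condition cannot fail, so membership in all the CPFs
  -- suffices.
  have hreg : ∀ t, 0 ≤ t → β t ∈ K → β t ∈ I.region S := by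
    intro t ht hK
    rw [mem_region_iff]
    refine ⟨fun i hi => ((I.mem_cpf_iff i _).1 (hK i hi)).1, α, fun p hp => ?_⟩
    have := (hα p hp).add_smul I.θ_pos I.θ_lt_pi ht
    have he : p - β t = p - x + t • viewDir α := by simp only [hβdef]; module
    rwa [he]
  obtain ⟨i₀, hi₀⟩ := hS
  have hleave : ∃ t, 0 ≤ t ∧ β t ∉ K := by
    have hb : 0 ≤ ‖x‖ + ‖(I.target i₀).start‖ + I.Rmax + 1 := by
      have := I.Rmin_nonneg.trans I.Rmin_le_Rmax
      positivity
    refine ⟨‖x‖ + ‖(I.target i₀).start‖ + I.Rmax + 1, hb, fun h => ?_⟩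
    have h1 := I.norm_le_of_mem_cpf i₀ (h i₀ hi₀)
    have h2 := norm_sub_norm_le ((‖x‖ + ‖(I.target i₀).start‖ + I.Rmax + 1) • viewDir α) x
    rw [norm_smul, norm_viewDir, mul_one, Real.norm_of_nonneg hb, norm_sub_rev] at h2
    simp only [hβdef] at h1
    linarith
  obtain ⟨T, hT, hin, hout⟩ := exists_exit_time hβ hK
    (by rw [hβ0]; exact fun i hi => I.mem_cpf_of_mem_region hx hi) hleave
  have hTK := hin T ⟨hT, le_rfl⟩
  refine ⟨β T, hreg T hT hTK, ?_, ?_⟩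
  · by_contra! hno
    have : ∀ᶠ t in 𝓝 T, ∀ i ∈ S, β t ∈ I.cpf i := by
      refine (Finset.eventually_all S).2 fun i hi => ?_
      refine hβ.continuousAt.preimage_mem_nhds (mem_interior_iff_mem_nhds.1 ?_)
      by_contra hint
      refine hno i ?_
      rw [(I.isClosed_cpf i).frontier_eq]
      exact ⟨hTK i hi, hint⟩
    obtain ⟨t, ⟨-, ht⟩, ht'⟩ := (hout.and_eventually this).exists
    exact ht ht'
  · have := joinedIn_of_continuous hβ hT fun t ht => hreg t ht.1 (hin t ht)
    rwa [hβ0] at this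

theorem exists_candidate_joinedIn (I : OLSC n u) {S : Finset (Fin n)} (hS : S.Nonempty)
    {x : Plane} (hx : x ∈ I.region S) :
    ∃ p ∈ I.candidates, p ∈ I.region S ∧ JoinedIn (I.region S) x p := by
  obtain ⟨y, hy, ⟨i, hi⟩, hxy⟩ := I.exists_joinedIn_frontier hS hx
  obtain ⟨p, hp, hpS, hyp⟩ := I.exists_candidate_of_mem_frontier hy hi
  exact ⟨p, hp, hpS, hxy.trans hyp⟩

end OLSC

/-! ### Greedy set cover -/

/-- A best set covers at least one uncovered element, so every pick strictly shrinks `U`. -/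
theorem GreedyRun.exists_of_coverable {ι : Type} [DecidableEq ι] [Fintype ι]
    {R : Set (Finset ι)} (hR : ∀ i, ∃ C ∈ R, i ∈ C) (U : Finset ι) : ∃ l, GreedyRun R U l := by
  induction U using Finset.strongInduction with
  | H U ih =>
    rcases U.eq_empty_or_nonempty with rfl | hU
    · exact ⟨[], .done⟩
    · obtain ⟨i, hi⟩ := hU
      obtain ⟨D, hD, hiD⟩ := hR i
      obtain ⟨C, hC, hmax⟩ := Set.exists_max_image R (fun C => (C ∩ U).card) (Set.toFinite R)
        ⟨D, hD⟩
      have hpos : 0 < (C ∩ U).card := lt_of_lt_of_le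
        (Finset.card_pos.2 ⟨i, Finset.mem_inter.2 ⟨hiD, hi⟩⟩) (hmax D hD)
      obtain ⟨j, hj⟩ := Finset.card_pos.1 hpos
      rw [Finset.mem_inter] at hj
      have hlt : U \ C ⊂ U := Finset.ssubset_iff_subset_ne.2
        ⟨Finset.sdiff_subset, fun h => (Finset.mem_sdiff.1 (h.symm ▸ hj.2)).2 hj.1⟩
      obtain ⟨l, hl⟩ := ih _ hlt
      exact ⟨C :: l, .pick U C l ⟨i, hi⟩ hC hmax hl⟩

/-- Every pick but the last multiplies the number of uncovered elements by at most `1 - 1 / k`,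
lowering its logarithm by at least `1 / k`, which pays for one set after multiplication by `k`. The
last pick is paid for by the summand `1`, as `k ≥ 1`. -/
theorem GreedyRun.length_le {ι : Type} [DecidableEq ι] {R : Set (Finset ι)} {k : ℕ}
    (D : Fin k → Finset ι) {U : Finset ι} {l : List (Finset ι)} (h : GreedyRun R U l)
    (hD : ∀ i ∈ U, ∃ m, D m ∈ R ∧ i ∈ D m) :
    (l.length : ℝ) ≤ (1 + Real.log U.card) * k := by
  induction h with
  | done => simp
  | pick U C l hU hC hmax hl ih =>
    have ih' := ih fun i hi => hD i (Finset.mem_sdiff.1 hi).1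
    have hk : 0 < k := by
      obtain ⟨i, hi⟩ := hU
      obtain ⟨m, -⟩ := hD i hi
      exact Fin.pos m
    -- Pigeonhole: at most `k` members of `R` cover `U`, and none meets it in more elements than
    -- `C`.
    have hcard : U.card ≤ k * (C ∩ U).card := by
      classical
      have hsub : U ⊆ (Finset.univ.filter fun m => D m ∈ R).biUnion fun m => D m ∩ U := by
        intro i hi
        obtain ⟨m, hm, him⟩ := hD i hi
        exact Finset.mem_biUnion.2 ⟨m, by simpa using hm, Finset.mem_inter.2 ⟨him, hi⟩⟩
      refine (Finset.card_le_card hsub).trans ((Finset.card_biUnion_le_card_mul _ _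
        (C ∩ U).card fun m hm => hmax _ (Finset.mem_filter.1 hm).2).trans ?_)
      refine Nat.mul_le_mul_right _ ?_
      simpa using Finset.card_filter_le (Finset.univ : Finset (Fin k)) fun m => D m ∈ R
    have hsplit : (U \ C).card + (C ∩ U).card = U.card := by
      rw [Finset.inter_comm]
      exact Finset.card_sdiff_add_card_inter U C
    have hkR : (1 : ℝ) ≤ k := by exact_mod_cast hk
    have hUpos : 0 < U.card := Finset.card_pos.2 hU
    have hUR : (1 : ℝ) ≤ U.card := by exact_mod_cast hUpos
    have hlogU := Real.log_nonneg hUR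
    rw [List.length_cons, Nat.cast_add, Nat.cast_one]
    rcases (U \ C).eq_empty_or_nonempty with hemp | hne
    · rw [hemp] at hl
      have hl0 : l = [] := by
        cases hl with
        | done => rfl
        | pick _ _ _ hU => exact absurd hU (by simp)
      rw [hl0]
      simp only [List.length_nil, Nat.cast_zero, zero_add]
      nlinarith
    · have hVpos : (0 : ℝ) < (U \ C).card := by exact_mod_cast Finset.card_pos.2 hne
      have hratio : ((U \ C).card : ℝ) ≤ U.card * (1 - 1 / k) := by
        have h1 : (U.card : ℝ) ≤ k * (C ∩ U).card := by exact_mod_cast hcard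
        have h2 : ((U \ C).card : ℝ) + (C ∩ U).card = U.card := by exact_mod_cast hsplit
        have h3 : (U.card : ℝ) / k ≤ (C ∩ U).card := by
          rw [div_le_iff₀ (by linarith)]
          linarith
        have h4 : (U.card : ℝ) * (1 - 1 / k) = U.card - U.card / k := by ring
        linarith
      have hfac : (0 : ℝ) < 1 - 1 / k := by
        by_contra! hle
        have := mul_nonpos_of_nonneg_of_nonpos (by linarith : (0 : ℝ) ≤ U.card) hle
        linarith
      have hlog : Real.log (U \ C).card ≤ Real.log U.card - 1 / k := by
        have h1 := Real.log_le_log hVpos hratio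
        rw [Real.log_mul (by linarith) hfac.ne'] at h1
        have h2 := Real.log_le_sub_one_of_pos hfac
        linarith
      have h3 : (1 + Real.log (U \ C).card) * k ≤ (1 + (Real.log U.card - 1 / k)) * k :=
        mul_le_mul_of_nonneg_right (by linarith) (by linarith)
      have h4 : (1 + (Real.log U.card - 1 / k)) * k = (1 + Real.log U.card) * k - 1 := by
        field_simp
        ring
      linarith

/-! ### From cameras to configurations -/

namespace OLSC

variable {n u : ℕ}

/-- The covered set is also covered from a candidate location, and there it extends to a maximal
one. -/
theorem exists_configuration_of_covers (I : OLSC n u) (x : Plane) (α : ℝ)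
    (hne : (I.cov x α).Nonempty) : ∃ C ∈ I.configurations, I.cov x α ⊆ C := by
  have hx : x ∈ I.region (I.cov x α) := ⟨α, fun i hi => by
    classical exact (Finset.mem_filter.1 hi).2⟩
  obtain ⟨p, hp, ⟨β, hβ⟩, -⟩ := I.exists_candidate_joinedIn hne hx
  obtain ⟨C, hC, hmax⟩ := Set.Finite.exists_le_maximal
    (s := {D | ∃ α : ℝ, D = I.cov p α}) (Set.toFinite _) ⟨β, rfl⟩
  refine ⟨C, ⟨p, hp, hmax⟩, fun i hi => hC ?_⟩
  classical exact Finset.mem_filter.2 ⟨Finset.mem_univ i, hβ i hi⟩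

theorem exists_configurations_of_cameras (I : OLSC n u) {k : ℕ} (c : Fin k → Plane × ℝ)
    (hc : ∀ i, ∃ m, I.Covers (c m).1 (c m).2 i) :
    ∃ D : Fin k → Finset (Fin n), ∀ i, ∃ m, D m ∈ I.configurations ∧ i ∈ D m := by
  have h : ∀ m, ∃ C : Finset (Fin n), (I.cov (c m).1 (c m).2).Nonempty →
      C ∈ I.configurations ∧ I.cov (c m).1 (c m).2 ⊆ C := by
    intro m
    by_cases hne : (I.cov (c m).1 (c m).2).Nonempty
    · obtain ⟨C, hC, hsub⟩ := I.exists_configuration_of_covers _ _ hne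
      exact ⟨C, fun _ => ⟨hC, hsub⟩⟩
    -- A camera covering nothing gets a dummy set, which need not be a configuration; hence
    -- membership is only claimed for the set that contains the given target.
    · exact ⟨∅, fun h => absurd h hne⟩
  choose D hD using h
  refine ⟨D, fun i => ?_⟩
  obtain ⟨m, hm⟩ := hc i
  have hi : i ∈ I.cov (c m).1 (c m).2 := by
    classical exact Finset.mem_filter.2 ⟨Finset.mem_univ i, hm⟩
  exact ⟨m, (hD m ⟨i, hi⟩).1, (hD m ⟨i, hi⟩).2 hi⟩

end OLSC

theorem mainTheorem5 {n u : ℕ} (I : OLSC n u) :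
    I.candidates.Finite ∧
    (∀ S : Finset (Fin n), S.Nonempty → ∀ x ∈ I.region S,
      ∃ p ∈ I.candidates, p ∈ I.region S ∧ JoinedIn (I.region S) x p) ∧
    (∀ (k : ℕ) (c : Fin k → Plane × ℝ), (∀ i, ∃ m, I.Covers (c m).1 (c m).2 i) →
      (∀ U : Finset (Fin n), ∃ l, GreedyRun I.configurations U l) ∧
      ∀ l, GreedyRun I.configurations Finset.univ l →
        (l.length : ℝ) ≤ (1 + Real.log n) * k) := by
  refine ⟨I.finite_candidates, fun S hS x hx => I.exists_candidate_joinedIn hS hx,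
    fun k c hc => ?_⟩
  obtain ⟨D, hD⟩ := I.exists_configurations_of_cameras c hc
  refine ⟨fun U => GreedyRun.exists_of_coverable (fun i => ?_) U, fun l hl => ?_⟩
  · obtain ⟨m, hm, hi⟩ := hD i
    exact ⟨D m, hm, hi⟩
  · simpa using hl.length_le D fun i _ => hD i
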